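/- **Setting.** Let $(\mathcal S,\mathcal A,p,q,\beta)$ be a finite Markov decision process with nonempty admissible action sets $\mathcal A(s)\subseteq\mathcal A$, transition probabilities $p(s'|s,a)$, initial distribution $q$ and discount factor $\beta\in[0,1)$. Let $\Lambda=\{(s,a): s\in\mathcal S,\ a\in\mathcal A(s)\}$ and $$\Delta_{\beta,q}=\Big\{\tau\in\mathbb R^{\Lambda}:\ \tau\ge 0,\ \sum_{(s,a)\in\Lambda}\tau(s,a)\big(\delta(s',s)-\beta p(s'|s,a)\big)=(1-\beta)q(s')\ \ \forall s'\in\mathcal S\Big\},$$ where $\delta(s',s)$ is the Kronecker delta. For a probability law $P$ on $\mathbb R^\Lambda$ and $\delta\ge0$ the K-L ball is $\{F \text{ a probability law}: D_{\mathrm{KL}}(F\|P)\le\delta\}$, with $D_{\mathrm{KL}}(F\|P)=\infty$ if $F\not\ll P$. A probability law $P$ on $\mathbb R^d$ is elliptical, $P=E_d(\mu,\Sigma,\psi)$, with $\Sigma$ positive semidefinite, if its characteristic function is $b\mapsto e^{ib^\top\mu}\,\psi(\tfrac12 b^\top\Sigma b)$ (so $\psi(t)=e^{-t}$ is the Gaussian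 case $N(\mu,\Sigma)$). Let $K\ge 0$, let $\delta_0,\dots,\delta_K\ge0$ be radii, $\xi_1,\dots,\xi_K\in\mathbb R$ thresholds and $\hat\epsilon\in(0,1]$. Let $\tilde F_k=E_{|\Lambda|}(\mu_k,\Sigma_k,\psi_k)$, $k=0,\dots,K$, be reference laws, $\mathcal F_k$ the K-L ball of radius $\delta_k$ around $\tilde F_k$, and $\mathcal F=\{F_1\times\cdots\times F_K: F_k\in\mathcal F_k\}$. The joint distributionally robust chance constrained MDP (J-DRCCMDP) is $$\max_{\tau\in\Delta_{\beta,q}}\ \inf_{F_0\in\mathcal F_0}\tfrac1{1-\beta}\mathbb E_{F_0}[\tau^\top r_0]\quad\text{s.t.}\quad \inf_{F\in\mathcal F}\mathbb P_F(\tau^\top r_k\ge\xi_k,\ k=1,\dots,K)\ge\hat\epsilon .$$ **Theorem.** Assume that $\Sigma_0$ is positive definite, that $\psi_0:\mathbb R\to\mathbb R$ is continuous, that the values of $\psi_0$ at negative arguments are given by analytic continuation (that is, $\psi_0$ is real-analytic at every point of $(-\infty,0]$), and that $\inf_{t\le0}\psi_0(t)\ge e^{-\delta_0}$. Let $\Phi_k$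 be the distribution function of $Z_k\sim E_1(0,1,\psi_k)$, let $\Phi_k^{-1}(p)=\sup\{z\in\mathbb R:\Phi_k(z)\le p\}\in[-\infty,\infty]$, and let $\tilde y_k=\inf_{x\in(0,1)}\frac{e^{-\delta_k}x^{y_k}-1}{x-1}$. Then (J-DRCCMDP) is equivalent to $$\begin{aligned}\min_{\tau,\alpha,y}\quad & f(\tau,\alpha):=-\tau^\top\mu_0+\alpha\log\Big[\psi_0\Big(-\frac{\tau^\top\Sigma_0\tau}{2\alpha^2}\Big)\Big]+\alpha\delta_0\\ \text{s.t.}\quad & \tau^\top\mu_k+\Phi_k^{-1}(1-\tilde y_k)\sqrt{\tau^\top\Sigma_k\tau}\ge\xi_k,\quad 0\le y_k\le1,\quad k=1,\dots,K,\\ & \prod_{k=1}^K y_k\ge\hat\epsilon,\qquad \alpha\ge0,\qquad \tau\in\Delta_{\beta,q},\end{aligned}$$ where $f(\tau,0)$ is read as $\limsup_{\alpha\downarrow0}f(\tau,\alpha)\in[-\infty,\infty]$ and $0\cdot(\pm\infty)=0$. Equivalence means: 1. $\tau^\top r_0$ is integrable under every $F_0\in\mathcal F_0$, so the robust objective is well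 defined; 2. $\tau$ is feasible for (J-DRCCMDP) if and only if $(\tau,\alpha,y)$ is feasible for the second problem for some $\alpha,y$; 3. for every $\tau\in\Delta_{\beta,q}$, $\ \inf_{F_0\in\mathcal F_0}\frac1{1-\beta}\mathbb E_{F_0}[\tau^\top r_0]=-\frac1{1-\beta}\inf_{\alpha\ge0}f(\tau,\alpha)$; 4. the optimal value of (J-DRCCMDP) is $-\frac1{1-\beta}$ times the optimal value of the second problem (in $[-\infty,\infty]$); 5. if $(\tau,\alpha,y)$ is optimal for the second problem, then $\tau$ is optimal for (J-DRCCMDP); conversely, if $\delta_0>0$, every optimal $\tau$ of (J-DRCCMDP) extends to an optimal $(\tau,\alpha,y)$. -/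

import Mathlib

open MeasureTheory ProbabilityTheory Filter Topology
open scoped ENNReal Matrix

noncomputable section

namespace DRCCMDP

/-- A finite discounted Markov decision process: state space `S`, action space `A`, the set
`adm s` of actions admissible at `s`, transition probabilities `p s a s'` (from `s` to `s'`
under the admissible action `a`), initial law `q`, discount factor `β ∈ [0,1)`. -/
structure MDP (S A : Type*) [Fintype S] where
  adm : S → Finset A
  adm_nonempty : ∀ s, (adm s).Nonempty
  p : (s : S) → adm s → S → ℝ
  p_nonneg : ∀ s a s', 0 ≤ p s a s'
  p_sum : ∀ s a, ∑ s', p s a s' = 1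
  q : S → ℝ
  q_nonneg : ∀ s, 0 ≤ q s
  q_sum : ∑ s, q s = 1
  β : ℝ
  β_nonneg : 0 ≤ β
  β_lt_one : β < 1

variable {S A : Type*} [Fintype S]

/-- The set `Λ` of admissible state-action pairs. -/
abbrev MDP.Pairs (M : MDP S A) : Type _ := Σ s : S, M.adm s

/-- Vectors indexed by `Λ`: reward vectors and occupation measures. -/
abbrev MDP.Vec (M : MDP S A) : Type _ := EuclideanSpace ℝ M.Pairs

open Classical in
/-- The polytope `Δ_{β,q}` of discounted occupation measures. -/
def MDP.occupation (M : MDP S A) : Set M.Vec :=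
  {τ | (∀ s' : S, ∑ x : M.Pairs, τ x * ((if s' = x.1 then 1 else 0) - M.β * M.p x.1 x.2 s')
          = (1 - M.β) * M.q s') ∧
        ∀ x, 0 ≤ τ x}

/-- The scalar product `aᵀ b`. -/
def dot {ι : Type*} [Fintype ι] (a b : EuclideanSpace ℝ ι) : ℝ := ∑ i, a i * b i

/-- The quadratic form `aᵀ Q a`. -/
def quad {ι : Type*} [Fintype ι] (Q : Matrix ι ι ℝ) (a : EuclideanSpace ℝ ι) : ℝ :=
  ∑ i, ∑ j, a i * Q i j * a j

/-- `P` is the elliptical law with location `m`, positive semidefinite dispersion matrix `Q` and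
characteristic generator `ψ`: its characteristic function is
`b ↦ exp (i bᵀ m) ψ (bᵀ Q b / 2)`.
With this normalization `ψ t = exp (-t)` gives the Gaussian law with covariance matrix `Q`. -/
structure IsElliptical {ι : Type*} [Fintype ι] (P : Measure (EuclideanSpace ℝ ι))
    (m : EuclideanSpace ℝ ι) (Q : Matrix ι ι ℝ) (ψ : ℝ → ℝ) : Prop where
  isProb : IsProbabilityMeasure P
  posSemidef : Q.PosSemidef
  charFun_eq : ∀ b : EuclideanSpace ℝ ι,
    charFun P b = Complex.exp ((dot b m : ℂ) * Complex.I) * (ψ (quad Q b / 2) : ℂ)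

/-- `ν` is the one-dimensional law `E₁(0, 1, ψ)`. -/
structure IsStdElliptical (ν : Measure ℝ) (ψ : ℝ → ℝ) : Prop where
  isProb : IsProbabilityMeasure ν
  charFun_eq : ∀ t : ℝ, charFun ν t = (ψ (t ^ 2 / 2) : ℂ)

/-- The inverse `Φ⁻¹(p) = sup {z | Φ(z) ≤ p}` of the distribution function `Φ` of `ν`, with
values in `[-∞, ∞]`. -/
def cdfInv (ν : Measure ℝ) (p : ℝ) : EReal := ⨆ (z : ℝ) (_ : cdf ν z ≤ p), (z : EReal)

/-- The Kullback-Leibler ball: all probability laws `F` with `D_KL(F ‖ P) ≤ δ`. -/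
def klBall {Ω : Type*} [MeasurableSpace Ω] (P : Measure Ω) (δ : ℝ) : Set (Measure Ω) :=
  {F | IsProbabilityMeasure F ∧ InformationTheory.klDiv F P ≤ ENNReal.ofReal δ}

/-- The data of a joint distributionally robust chance constrained MDP with `K` constraints and
K-L ambiguity: reference laws `P₀`, `P k` of the reward vectors, radii `δ₀`, `δ k`, thresholds
`ξ k`, joint confidence level `ε`. -/
structure JointProblem (S A : Type*) [Fintype S] (K : ℕ) extends MDP S A where
  P₀ : Measure toMDP.Vec
  P : Fin K → Measure toMDP.Vec
  δ₀ : ℝ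
  δ : Fin K → ℝ
  ξ : Fin K → ℝ
  ε : ℝ

namespace JointProblem

variable {K : ℕ} (J : JointProblem S A K)

/-- Vectors indexed by the admissible state-action pairs. -/
abbrev Vec : Type _ := J.toMDP.Vec

/-- The ambiguity set of the law of `r₀`. -/
def amb₀ : Set (Measure J.Vec) := klBall J.P₀ J.δ₀

/-- The ambiguity set of the joint law of `(r₁, …, r_K)`: products of independent marginals, the
`k`-th one in the K-L ball of radius `δ k` around `P k`. -/
def amb : Set (Measure (Fin K → J.Vec)) :=
  {F | ∃ G : Fin K → Measure J.Vec, (∀ k, G k ∈ klBall (J.P k) (J.δ k)) ∧ F = Measure.pi G}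

/-- The robust objective `inf_{F₀} (1 - β)⁻¹ E_{F₀}[τᵀ r₀]`, to be maximized. -/
def objective (τ : J.Vec) : EReal :=
  ⨅ F ∈ J.amb₀, (((1 / (1 - J.β)) * ∫ r, dot τ r ∂F : ℝ) : EReal)

/-- The feasible set: `τ ∈ Δ_{β,q}` and `inf_F P_F(τᵀ r_k ≥ ξ_k for all k) ≥ ε`. -/
def feasible : Set J.Vec :=
  {τ | τ ∈ J.occupation ∧
    ENNReal.ofReal J.ε ≤ ⨅ F ∈ J.amb, F {r | ∀ k, J.ξ k ≤ dot τ (r k)}}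

/-- The optimal value `max_τ inf_{F₀} (1 - β)⁻¹ E_{F₀}[τᵀ r₀]`. -/
def value : EReal := ⨆ τ ∈ J.feasible, J.objective τ

/-- `τ` is an optimal solution. -/
def IsOptimal (τ : J.Vec) : Prop := τ ∈ J.feasible ∧ IsMaxOn J.objective J.feasible τ

end JointProblem

/-- `inf_{x ∈ (0,1)} (e^{-δ} x^y - 1) / (x - 1)`. -/
def yTilde (δ y : ℝ) : ℝ :=
  sInf ((fun x : ℝ => (Real.exp (-δ) * x ^ y - 1) / (x - 1)) '' Set.Ioo 0 1)

/-- Parameters of the reformulated problem: location, dispersion and generator of each reference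
law, and the law `ν k` of the standardized variable `Z_k`. -/
structure EllipticalData {S A : Type*} [Fintype S] {K : ℕ} (J : JointProblem S A K) where
  μ₀ : J.Vec
  Q₀ : Matrix J.Pairs J.Pairs ℝ
  ψ₀ : ℝ → ℝ
  μ : Fin K → J.Vec
  Q : Fin K → Matrix J.Pairs J.Pairs ℝ
  ψ : Fin K → ℝ → ℝ
  ν : Fin K → Measure ℝ

namespace EllipticalData

variable {K : ℕ} {J : JointProblem S A K} (D : EllipticalData J)

/-- The closed-form objective
`-τᵀμ₀ + α log ψ₀(-τᵀQ₀τ / (2 α²)) + α δ₀`, meaningful for `α > 0`. -/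
def objectivePos (τ : J.Vec) (α : ℝ) : ℝ :=
  -dot τ D.μ₀ + α * Real.log (D.ψ₀ (-(quad D.Q₀ τ) / (2 * α ^ 2))) + α * J.δ₀

open Classical in
/-- The closed-form objective for `α ≥ 0`; at `α = 0` it is read as the (upper) limit `α ↓ 0`. -/
def objective (τ : J.Vec) (α : ℝ) : EReal :=
  if 0 < α then (D.objectivePos τ α : EReal)
  else limsup (fun a : ℝ => (D.objectivePos τ a : EReal)) (𝓝[>] 0)

/-- The feasible triples `(τ, α, y)` of the reformulated problem. -/
def feasible : Set (J.Vec × ℝ × (Fin K → ℝ)) :=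
  {z | (∀ k, (J.ξ k : EReal) ≤ (dot z.1 (D.μ k) : EReal) +
            cdfInv (D.ν k) (1 - yTilde (J.δ k) (z.2.2 k)) *
              (Real.sqrt (quad (D.Q k) z.1) : EReal)) ∧
        (∀ k, 0 ≤ z.2.2 k ∧ z.2.2 k ≤ 1) ∧
        J.ε ≤ ∏ k, z.2.2 k ∧
        0 ≤ z.2.1 ∧
        z.1 ∈ J.occupation}

/-- The optimal value `min_{τ,α,y}` of the reformulated problem. -/
def value : EReal := ⨅ z ∈ D.feasible, D.objective z.1 z.2.1

/-- `(τ, α, y)` is an optimal solution of the reformulated problem. -/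
def IsOptimal (z : J.Vec × ℝ × (Fin K → ℝ)) : Prop :=
  z ∈ D.feasible ∧ IsMinOn (fun w => D.objective w.1 w.2.1) D.feasible z

end EllipticalData

end DRCCMDP

end

/-! The objective and the chance constraint are reformulated separately; `α` occurs only in the
first and `y` only in the second. Objective: `Y = τᵀμ₀ - τᵀr₀` has a real characteristic function
`ψ₀(c t²)`, `c ≥ 0`. Analyticity of `ψ₀` on `(-∞, 0]` makes all exponential moments of `Y` finite,
with moment generating function `ψ₀(-c s²)` (`mgf_of_charFun_comp_sq`). Donsker-Varadhan then bounds
the mean of `Y` over the K-L ball by `(cgf s + δ₀) / s`, which is the closed form with `α = 1 / s`.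
Exponential tilts of the reference law show that the bound is sharp (`exists_mem_klBall_of_pos`);
the limits `s → ∞` and `s → 0` account for `α = 0` and for `δ₀ = 0`. Constraint: independence
factors the joint probability, so feasibility means that lower bounds `y k` on the worst-case
marginal probabilities have product at least `ε`. For a single event `A`, the bound `y ≤ F(A)` on
the whole ball amounts to `yTilde δ y ≤ P(A)`, again by Donsker-Varadhan and tilting, now with
multiples of the indicator of `A`. A quantile of the standardized projection turns this into the
second-order cone type constraint. -/

namespace DRCCMDP

/-! ### Finite even moments from an analytic characteristic function -/

section Moments

theorem memLp_id_of_integrable_even_pow {ν : Measure ℝ} [IsFiniteMeasure ν] {n : ℕ}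
    (h : Integrable (fun x : ℝ => x ^ (2 * n)) ν) : MemLp id (2 * n : ℕ) ν := by
  rcases Nat.eq_zero_or_pos n with rfl | hn
  · simpa using (aestronglyMeasurable_id : AEStronglyMeasurable (id : ℝ → ℝ) ν)
  · refine (integrable_norm_rpow_iff aestronglyMeasurable_id (by simp; omega) (ENNReal.natCast_ne_top _)).1 ?_
    refine h.congr (ae_of_all _ fun x => ?_)
    simp only [id, Real.norm_eq_abs, ENNReal.toReal_natCast, Real.rpow_natCast]
    rw [pow_mul, pow_mul, sq_abs]

theorem iteratedDeriv_eq_integral_cos {ν : Measure ℝ} [IsFiniteMeasure ν] {f : ℝ → ℝ}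
    (hf : ∀ᶠ t in 𝓝 0, charFun ν t = f t) {n : ℕ}
    (h : Integrable (fun x : ℝ => x ^ (2 * n)) ν) :
    ∀ᶠ t in 𝓝 0, ∫ x, x ^ (2 * n) * Real.cos (t * x) ∂ν = (-1) ^ n * iteratedDeriv (2 * n) f t := by
  have hL := memLp_id_of_integrable_even_pow h
  have hfre : f =ᶠ[𝓝 0] (Complex.reCLM ∘ charFun ν) := by
    filter_upwards [hf] with t ht
    simp [ht]
  filter_upwards [hfre.iteratedDeriv (2 * n)] with t ht
  rw [ht, iteratedDeriv_eq_iteratedFDeriv,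
    Complex.reCLM.iteratedFDeriv_comp_left (contDiff_charFun hL).contDiffAt le_rfl]
  simp only [ContinuousLinearMap.compContinuousMultilinearMap_coe, Function.comp_apply]
  rw [← iteratedDeriv_eq_iteratedFDeriv, iteratedDeriv_charFun hL, pow_mul, Complex.I_sq]
  have h1 : Integrable (fun x : ℝ => (x : ℂ) ^ (2 * n) * Complex.exp (t * x * Complex.I)) ν := by
    refine (h.norm).mono' (by fun_prop) (ae_of_all _ fun x => ?_)
    rw [norm_mul, ← Complex.ofReal_mul, Complex.norm_exp_ofReal_mul_I]
    simp
  have h2 : (∫ x : ℝ, (x : ℂ) ^ (2 * n) * Complex.exp (t * x * Complex.I) ∂ν).re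
      = ∫ x : ℝ, x ^ (2 * n) * Real.cos (t * x) ∂ν := by
    rw [← Complex.reCLM_apply, ← Complex.reCLM.integral_comp_comm h1]
    refine integral_congr_ae (ae_of_all _ fun x => ?_)
    simp only [Complex.reCLM_apply]
    rw [← Complex.ofReal_pow, Complex.re_ofReal_mul, ← Complex.ofReal_mul,
      Complex.exp_ofReal_mul_I_re]
  have h3 : ((-1 : ℂ) ^ n) = (((-1 : ℝ) ^ n : ℝ) : ℂ) := by push_cast; rfl
  rw [h3, Complex.reCLM_apply, Complex.re_ofReal_mul, h2, ← mul_assoc, ← mul_pow]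
  simp

/-- In the symmetric difference the constant and linear Taylor terms cancel, leaving twice the
second-order remainder bound. -/
theorem exists_bound_second_difference {g : ℝ → ℝ} (hg : AnalyticAt ℝ g 0) :
    ∃ C : ℝ, ∀ᶠ t in 𝓝 0, |2 * g 0 - g t - g (-t)| ≤ C * t ^ 2 := by
  obtain ⟨p, hp⟩ := hg
  have h0 : p.coeff 0 = g 0 := hp.coeff_zero _
  obtain ⟨C, hC⟩ := (hp.isBigO_sub_partialSum_pow 2).bound
  have hC' : ∀ᶠ t in 𝓝 (0 : ℝ), ‖g (0 + -t) - p.partialSum 2 (-t)‖ ≤ C * ‖‖-t‖ ^ 2‖ := by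
    have : Tendsto (fun t : ℝ => -t) (𝓝 0) (𝓝 0) := by simpa using (continuous_neg.tendsto (0:ℝ))
    exact this.eventually hC
  refine ⟨2 * C, ?_⟩
  filter_upwards [hC, hC'] with t h1 h2
  simp only [FormalMultilinearSeries.partialSum, Finset.sum_range_succ, Finset.sum_range_zero,
    FormalMultilinearSeries.apply_eq_pow_smul_coeff, h0, zero_add, pow_zero, pow_one,
    smul_eq_mul, norm_neg, norm_pow, Real.norm_eq_abs, sq_abs] at h1 h2
  rw [abs_le] at *
  constructor <;> nlinarith

theorem tendsto_two_mul_one_sub_cos_div (x : ℝ) :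
    Tendsto (fun t : ℝ => 2 * (1 - Real.cos (t * x)) / t ^ 2) (𝓝[≠] 0) (𝓝 (x ^ 2)) := by
  have hs : Tendsto (fun t : ℝ => (Real.sin (t * (x / 2)) / t)) (𝓝[≠] 0) (𝓝 (x / 2)) := by
    have hd : HasDerivAt (fun t : ℝ => Real.sin (t * (x / 2))) (x / 2) 0 := by
      simpa using ((hasDerivAt_id (0 : ℝ)).mul_const (x / 2)).sin
    have := hd.tendsto_slope_zero
    simpa [div_eq_inv_mul] using this
  have h2 := (hs.pow 2).const_mul 4
  have e : 4 * (x / 2) ^ 2 = x ^ 2 := by ring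
  rw [e] at h2
  refine h2.congr fun t => ?_
  have : Real.cos (t * x) = 1 - 2 * Real.sin (t * (x / 2)) ^ 2 := by
    rw [show t * x = 2 * (t * (x / 2)) by ring, Real.cos_two_mul, Real.cos_sq']; ring
  rw [this, div_pow]; ring

/-- Induction on `n`: up to sign, the second difference at 0 of the `2n`-th derivative is the
integral of `x ^ (2n) * 2 (1 - cos (t x))`, hence `O(t²)`. After division by `t²` the integrand
tends to `x ^ (2n + 2)`, and Fatou's lemma gives integrability. -/
theorem integrable_even_pow_of_charFun {ν : Measure ℝ} [IsFiniteMeasure ν] {f : ℝ → ℝ}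
    (hfa : AnalyticAt ℝ f 0) (hf : ∀ᶠ t in 𝓝 0, charFun ν t = f t) (n : ℕ) :
    Integrable (fun x : ℝ => x ^ (2 * n)) ν := by
  induction n with
  | zero => simp
  | succ n ih =>
    have hga : AnalyticAt ℝ (iteratedDeriv (2 * n) f) 0 := by
      rw [iteratedDeriv_eq_iterate]; exact hfa.iterated_deriv _
    have hint := iteratedDeriv_eq_integral_cos hf ih
    obtain ⟨C, hC⟩ := exists_bound_second_difference hga
    have hneg : Tendsto (fun t : ℝ => -t) (𝓝 0) (𝓝 0) := by
      simpa using (continuous_neg.tendsto (0:ℝ))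
    have hbd : ∀ᶠ t in 𝓝 (0 : ℝ),
        ∫ x, x ^ (2 * n) * (2 * (1 - Real.cos (t * x))) ∂ν ≤ C * t ^ 2 := by
      filter_upwards [hC, hint, hneg.eventually hint] with t h1 h2 h3
      have h0 := hint.self_of_nhds
      simp only [zero_mul, Real.cos_zero, mul_one] at h0
      have hi : ∀ s : ℝ, Integrable (fun x : ℝ => x ^ (2 * n) * Real.cos (s * x)) ν := fun s =>
        ih.norm.mono' (by fun_prop) (ae_of_all _ fun x => by
          rw [norm_mul]
          exact mul_le_of_le_one_right (norm_nonneg _) (Real.abs_cos_le_one _))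
      have e : ∫ x, x ^ (2 * n) * (2 * (1 - Real.cos (t * x))) ∂ν
          = 2 * ∫ x, x ^ (2 * n) ∂ν - ∫ x, x ^ (2 * n) * Real.cos (t * x) ∂ν
            - ∫ x, x ^ (2 * n) * Real.cos (-t * x) ∂ν := by
        rw [← integral_const_mul, ← integral_sub (ih.const_mul 2) (hi t),
          ← integral_sub (f := fun x => 2 * x ^ (2 * n) - x ^ (2 * n) * Real.cos (t * x))
            ((ih.const_mul 2).sub (hi t)) (hi (-t))]
        refine integral_congr_ae (ae_of_all _ fun x => ?_)
        simp only [neg_mul, Real.cos_neg]; ring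
      rw [e, h0, h2, h3]
      calc _ = (-1) ^ n * (2 * iteratedDeriv (2 * n) f 0 - iteratedDeriv (2 * n) f t
            - iteratedDeriv (2 * n) f (-t)) := by ring
        _ ≤ |(-1) ^ n * (2 * iteratedDeriv (2 * n) f 0 - iteratedDeriv (2 * n) f t
            - iteratedDeriv (2 * n) f (-t))| := le_abs_self _
        _ = |2 * iteratedDeriv (2 * n) f 0 - iteratedDeriv (2 * n) f t
            - iteratedDeriv (2 * n) f (-t)| := by rw [abs_mul]; simp
        _ ≤ C * t ^ 2 := h1
    -- Fatou's lemma needs a sequence, so `t → 0` is taken along `1 / (k + 1)`.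
    have hu : Tendsto (fun k : ℕ => (1 : ℝ) / ((k : ℝ) + 1)) atTop (𝓝[≠] 0) :=
      tendsto_nhdsWithin_iff.2 ⟨tendsto_one_div_add_atTop_nhds_zero_nat,
        Eventually.of_forall fun k => by
          have : (0 : ℝ) < 1 / ((k : ℝ) + 1) := by positivity
          exact this.ne'⟩
    refine integrable_of_tendsto (G := fun k x =>
      x ^ (2 * n) * (2 * (1 - Real.cos ((1 / ((k : ℝ) + 1)) * x)) / (1 / ((k : ℝ) + 1)) ^ 2))
      (ae_of_all _ fun x => ?_) (fun k => by fun_prop) ?_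
    · have := (((tendsto_two_mul_one_sub_cos_div x).comp hu).const_mul (x ^ (2 * n)))
      rw [show x ^ (2 * (n + 1)) = x ^ (2 * n) * x ^ 2 by ring]
      exact this
    · have hle : ∀ᶠ k : ℕ in atTop, ∫⁻ x, ‖x ^ (2 * n) *
          (2 * (1 - Real.cos ((1 / ((k : ℝ) + 1)) * x)) / (1 / ((k : ℝ) + 1)) ^ 2)‖ₑ ∂ν
          ≤ ENNReal.ofReal C := by
        filter_upwards [(hu.mono_right nhdsWithin_le_nhds).eventually hbd] with k hk
        set t : ℝ := 1 / ((k : ℝ) + 1) with ht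
        have htpos : 0 < t := by positivity
        have hnn : ∀ x : ℝ, 0 ≤ x ^ (2 * n) * (2 * (1 - Real.cos (t * x)) / t ^ 2) := fun x => by
          have := Real.cos_le_one (t * x)
          have h4 : 0 ≤ x ^ (2 * n) := (even_two_mul n).pow_nonneg x
          have : 0 ≤ 1 - Real.cos (t * x) := by linarith
          positivity
        have hi : Integrable (fun x : ℝ => x ^ (2 * n) * (2 * (1 - Real.cos (t * x)) / t ^ 2)) ν := by
          refine (ih.norm.const_mul (4 / t ^ 2)).mono' (by fun_prop) (ae_of_all _ fun x => ?_)
          rw [Real.norm_of_nonneg (hnn x), Real.norm_eq_abs,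
            abs_of_nonneg ((even_two_mul n).pow_nonneg x), mul_comm]
          have h5 := Real.neg_one_le_cos (t * x)
          gcongr
          · exact (even_two_mul n).pow_nonneg x
          · linarith
        rw [← ofReal_integral_norm_eq_lintegral_enorm hi]
        refine ENNReal.ofReal_le_ofReal ?_
        have e : ∫ x, ‖x ^ (2 * n) * (2 * (1 - Real.cos (t * x)) / t ^ 2)‖ ∂ν
            = (∫ x, x ^ (2 * n) * (2 * (1 - Real.cos (t * x))) ∂ν) / t ^ 2 := by
          rw [← integral_div]
          refine integral_congr_ae (ae_of_all _ fun x => ?_)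
          simp only [Real.norm_of_nonneg (hnn x)]; ring
        rw [e, div_le_iff₀ (by positivity)]
        exact hk
      refine ne_top_of_le_ne_top (b := ENNReal.ofReal C) ENNReal.ofReal_ne_top ?_
      exact liminf_le_of_frequently_le' hle.frequently

theorem integral_even_pow_of_charFun {ν : Measure ℝ} [IsFiniteMeasure ν] {f : ℝ → ℝ}
    (hfa : AnalyticAt ℝ f 0) (hf : ∀ᶠ t in 𝓝 0, charFun ν t = f t) (n : ℕ) :
    ∫ x, x ^ (2 * n) ∂ν = (-1) ^ n * iteratedDeriv (2 * n) f 0 := by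
  have := (iteratedDeriv_eq_integral_cos hf (integrable_even_pow_of_charFun hfa hf n)).self_of_nhds
  simpa using this

/-- All terms of the cosh series are nonnegative, so convergence of the integrated series alone
allows termwise integration. The weight `w` is 1 at the origin and `exp (s₀ x)` when expanding
around another point. -/
theorem integrable_cosh_mul {ν : Measure ℝ} {w : ℝ → ℝ} (hw : ∀ x, 0 ≤ w x) {h : ℝ}
    (hi : ∀ n : ℕ, Integrable (fun x : ℝ => x ^ (2 * n) * w x) ν) {a : ℝ}
    (hs : HasSum (fun n : ℕ => h ^ (2 * n) / (2 * n).factorial * ∫ x, x ^ (2 * n) * w x ∂ν) a) :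
    Integrable (fun x => Real.cosh (h * x) * w x) ν ∧ ∫ x, Real.cosh (h * x) * w x ∂ν = a := by
  set F : ℕ → ℝ → ℝ := fun n x => (h * x) ^ (2 * n) / (2 * n).factorial * w x with hF
  have hFe : ∀ n, F n = fun x => h ^ (2 * n) / (2 * n).factorial * (x ^ (2 * n) * w x) := by
    intro n; funext x; simp only [hF, mul_pow]; ring
  have hFnn : ∀ n x, 0 ≤ F n x := fun n x => by
    have := (even_two_mul n).pow_nonneg (h * x)
    have := hw x
    simp only [hF]; positivity
  have hFi : ∀ n, Integrable (F n) ν := fun n => by rw [hFe]; exact (hi n).const_mul _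
  have hFint : ∀ n, ∫ x, F n x ∂ν = h ^ (2 * n) / (2 * n).factorial * ∫ x, x ^ (2 * n) * w x ∂ν :=
    fun n => by rw [hFe, integral_const_mul]
  have hFsum : ∀ x, HasSum (fun n => F n x) (Real.cosh (h * x) * w x) := fun x =>
    (Real.hasSum_cosh (h * x)).mul_right (w x)
  have hs' : HasSum (fun n => ∫ x, F n x ∂ν) a := by simpa only [hFint] using hs
  have hnorm : ∀ n, ∫ x, ‖F n x‖ ∂ν = ∫ x, F n x ∂ν := fun n =>
    integral_congr_ae (ae_of_all _ fun x => Real.norm_of_nonneg (hFnn n x))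
  refine ⟨?_, ?_⟩
  · refine integrable_of_tendsto (G := fun N x => ∑ n ∈ Finset.range N, F n x)
      (ae_of_all _ fun x => (hFsum x).tendsto_sum_nat)
      (fun N => (integrable_finsetSum _ fun n _ => hFi n).aestronglyMeasurable) ?_
    refine ne_top_of_le_ne_top (b := ENNReal.ofReal a) ENNReal.ofReal_ne_top ?_
    refine liminf_le_of_frequently_le' (Eventually.frequently (Eventually.of_forall fun N => ?_))
    have hiN : Integrable (fun x => ∑ n ∈ Finset.range N, F n x) ν :=
      integrable_finsetSum _ fun n _ => hFi n
    rw [← ofReal_integral_norm_eq_lintegral_enorm hiN]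
    refine ENNReal.ofReal_le_ofReal ?_
    have e : ∫ x, ‖∑ n ∈ Finset.range N, F n x‖ ∂ν = ∑ n ∈ Finset.range N, ∫ x, F n x ∂ν := by
      rw [← integral_finsetSum _ fun n _ => hFi n]
      exact integral_congr_ae (ae_of_all _ fun x =>
        Real.norm_of_nonneg (Finset.sum_nonneg fun n _ => hFnn n x))
    rw [e]
    exact sum_le_hasSum _ (fun n _ => integral_nonneg (hFnn n)) hs'
  · have h1 := hasSum_integral_of_summable_integral_norm hFi
      (by simpa only [hnorm] using hs'.summable)
    have h2 := h1.unique hs'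
    rw [← h2]
    exact integral_congr_ae (ae_of_all _ fun x => (hFsum x).tsum_eq.symm)

end Moments

/-! ### Analytic continuation of the moment generating function -/

section MomentGenerating

/-- A Pringsheim-type argument: the even Taylor terms of `g` at `s₀` are the integrated terms of
`cosh (h x) exp (s₀ x)`, so this function is integrable, and twice it dominates `exp ((s₀ + h) x)`.
-/
theorem mem_integrableExpSet_add_of_hasFPowerSeriesOnBall {ν : Measure ℝ} {g : ℝ → ℝ}
    {p : FormalMultilinearSeries ℝ ℝ ℝ} {s₀ h : ℝ} {r : ℝ≥0∞} (hp : HasFPowerSeriesOnBall g p s₀ r)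
    (hs₀ : s₀ ∈ interior (integrableExpSet id ν)) (hg : mgf id ν =ᶠ[𝓝 s₀] g)
    (hh : (‖h‖₊ : ℝ≥0∞) < r) : s₀ + h ∈ integrableExpSet id ν := by
  have hsum := (hp.hasSum_iteratedFDeriv (y := h) (by
    simpa [Metric.mem_eball, edist_zero_right] using (show ‖h‖ₑ < r from hh))).summable
  have hterm : ∀ n : ℕ, ((n.factorial : ℝ))⁻¹ • iteratedFDeriv ℝ n g s₀ (fun _ => h)
      = h ^ n / n.factorial * ∫ x, x ^ n * Real.exp (s₀ * x) ∂ν := by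
    intro n
    rw [iteratedFDeriv_apply_eq_iteratedDeriv_mul_prod, ← hg.iteratedDeriv_eq n,
      iteratedDeriv_mgf hs₀]
    simp only [Finset.prod_const, Finset.card_univ, Fintype.card_fin, smul_eq_mul, id]
    ring
  have hsum2 : Summable (fun n : ℕ => h ^ (2 * n) / (2 * n).factorial *
      ∫ x, x ^ (2 * n) * Real.exp (s₀ * x) ∂ν) := by
    have := hsum.comp_injective (i := fun n : ℕ => 2 * n) (fun a b hab => by simpa using hab)
    simpa only [Function.comp_def, hterm] using this
  have hmom : ∀ n : ℕ, Integrable (fun x : ℝ => x ^ (2 * n) * Real.exp (s₀ * x)) ν := fun n =>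
    integrable_pow_mul_exp_of_mem_interior_integrableExpSet hs₀ (2 * n)
  have hc := (integrable_cosh_mul (fun x => (Real.exp_pos _).le) hmom hsum2.hasSum).1
  refine (hc.const_mul 2).mono' (by simp only [id]; fun_prop) (ae_of_all _ fun x => ?_)
  rw [Real.norm_of_nonneg (Real.exp_pos _).le, id, add_mul, Real.exp_add, Real.cosh_eq]
  have := Real.exp_pos (-(h * x))
  have := Real.exp_pos (s₀ * x)
  nlinarith [mul_pos (Real.exp_pos (-(h * x))) (Real.exp_pos (s₀ * x))]

theorem integrableExpSet_eq_univ_of_analytic {ν : Measure ℝ} {g : ℝ → ℝ}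
    (hg : ∀ s, AnalyticAt ℝ g s) (h0 : 0 ∈ interior (integrableExpSet id ν))
    (hev : mgf id ν =ᶠ[𝓝 0] g) : integrableExpSet id ν = Set.univ ∧ mgf id ν = g := by
  set I := interior (integrableExpSet id ν) with hI
  have hpre : IsPreconnected I := convex_integrableExpSet.interior.isPreconnected
  have heq : Set.EqOn (mgf id ν) g I :=
    analyticOnNhd_mgf.eqOn_of_preconnected_of_eventuallyEq (fun s _ => hg s) hpre h0 hev
  -- The interior of the integrability set is shown to be closed, hence all of `ℝ`: the expansion of
  -- `g` at a limit point `s`, recentred at a nearby `s₀` in the interior, still converges on a ball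
  -- around `s`. Distances below `ρ / 3` keep `|x - s₀| + |s₀ - s| ≤ ρ`.
  have hclosed : IsClosed I := by
    refine isClosed_of_closure_subset fun s hs => ?_
    obtain ⟨p, r, hp⟩ := hg s
    obtain ⟨ρ, hρ, hρr⟩ := ENNReal.lt_iff_exists_nnreal_btwn.1 hp.r_pos
    have hρ' : 0 < ρ := by exact_mod_cast hρ
    obtain ⟨s₀, hs₀, hd⟩ := Metric.mem_closure_iff.1 hs (ρ / 3) (by positivity)
    have hy : ‖s₀ - s‖ < ρ / 3 := by rw [← dist_eq_norm, dist_comm]; exact hd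
    have hyr : (‖s₀ - s‖₊ : ℝ≥0∞) < r := by
      refine lt_of_le_of_lt ?_ hρr
      have : ‖s₀ - s‖₊ ≤ ρ := by
        rw [← NNReal.coe_le_coe, coe_nnnorm]
        have : (0 : ℝ) < ρ := hρ'
        linarith
      exact_mod_cast this
    have hp' := hp.changeOrigin hyr
    rw [add_sub_cancel] at hp'
    have hev' : mgf id ν =ᶠ[𝓝 s₀] g := by
      filter_upwards [isOpen_interior.mem_nhds hs₀] with x hx using heq hx
    have hball : Metric.ball s (ρ / 3) ⊆ integrableExpSet id ν := by
      intro x hx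
      have := mem_integrableExpSet_add_of_hasFPowerSeriesOnBall (h := x - s₀) hp' hs₀ hev' ?_
      · simpa using this
      · rw [lt_tsub_iff_right]
        refine lt_of_le_of_lt ?_ hρr
        have h1 : ‖x - s₀‖₊ + ‖s₀ - s‖₊ ≤ ρ := by
          rw [← NNReal.coe_le_coe, NNReal.coe_add, coe_nnnorm, coe_nnnorm]
          have h2 : ‖x - s₀‖ ≤ ‖x - s‖ + ‖s₀ - s‖ := by
            rw [show x - s₀ = (x - s) - (s₀ - s) by ring]; exact norm_sub_le _ _
          have h3 : ‖x - s‖ < ρ / 3 := by simpa [Real.dist_eq] using hx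
          linarith
        exact_mod_cast h1
    exact mem_interior.2 ⟨_, hball, Metric.isOpen_ball, Metric.mem_ball_self (by positivity)⟩
  have huniv : I = Set.univ := IsClopen.eq_univ ⟨hclosed, isOpen_interior⟩ ⟨0, h0⟩
  refine ⟨Set.eq_univ_of_univ_subset (huniv ▸ interior_subset), funext fun s => heq ?_⟩
  rw [huniv]; trivial

theorem integral_even_pow_of_charFun_comp_sq {ν : Measure ℝ} [IsFiniteMeasure ν] {ψ : ℝ → ℝ} {c : ℝ}
    {p : FormalMultilinearSeries ℝ ℝ ℝ} (hp : HasFPowerSeriesAt ψ p 0)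
    (hν : ∀ t, charFun ν t = ψ (c * t ^ 2)) (n : ℕ) :
    Integrable (fun x : ℝ => x ^ (2 * n)) ν ∧
      ∫ x, x ^ (2 * n) ∂ν = (2 * n).factorial * ((-c) ^ n * p.coeff n) := by
  set f : ℝ → ℝ := fun t => ψ (c * t ^ 2) with hf
  -- Coefficients of `ψ (c t²)`: those of `ψ`, scaled and moved to even positions.
  set b : ℕ → ℝ := fun m => if Even m then c ^ (m / 2) * p.coeff (m / 2) else 0 with hb
  have hlim : Tendsto (fun t : ℝ => c * t ^ 2) (𝓝 0) (𝓝 0) := by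
    have : Continuous (fun t : ℝ => c * t ^ 2) := by fun_prop
    simpa using this.tendsto 0
  have hfp : HasFPowerSeriesAt f (FormalMultilinearSeries.ofScalars ℝ b) 0 := by
    rw [hasFPowerSeriesAt_iff]
    filter_upwards [hlim.eventually (hasFPowerSeriesAt_iff.1 hp)] with t ht
    simp only [FormalMultilinearSeries.coeff_ofScalars, zero_add] at ht ⊢
    have hinj : Function.Injective (fun n : ℕ => 2 * n) := fun a b hab => by simpa using hab
    refine (hinj.hasSum_iff fun m hm => ?_).1 ?_
    · have : ¬ Even m := fun ⟨k, hk⟩ => hm ⟨k, by simp only; omega⟩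
      simp [hb, this]
    · convert! ht using 2 with k
      simp only [Function.comp, hb, even_two_mul, if_true, smul_eq_mul,
        Nat.mul_div_cancel_left k two_pos]
      rw [mul_pow, ← pow_mul]; ring
  have hfa : AnalyticAt ℝ f 0 := ⟨_, hfp⟩
  have hev : ∀ᶠ t in 𝓝 0, charFun ν t = f t := Eventually.of_forall hν
  refine ⟨integrable_even_pow_of_charFun hfa hev n, ?_⟩
  rw [integral_even_pow_of_charFun hfa hev n]
  have h1 := congrArg (fun q => q.coeff (2 * n))
    (hfp.eq_formalMultilinearSeries hfa.hasFPowerSeriesAt)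
  simp only [FormalMultilinearSeries.coeff_ofScalars, hb, even_two_mul, if_true,
    Nat.mul_div_cancel_left n two_pos] at h1
  rw [eq_div_iff (by positivity)] at h1
  rw [← h1, neg_pow]; ring

theorem map_neg_eq_self_of_charFun_real {ν : Measure ℝ} [IsFiniteMeasure ν] {f : ℝ → ℝ}
    (hν : ∀ t, charFun ν t = f t) : ν.map (fun x => -x) = ν := by
  refine Measure.ext_of_charFun (funext fun t => ?_)
  have h := charFun_map_mul (μ := ν) (-1) t
  simp only [neg_mul, one_mul] at h
  rw [h, charFun_neg, hν t, Complex.conj_ofReal]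

/-- The even moments are `(2n)! (-c)ⁿ` times the Taylor coefficients of `ψ`, so near 0 the integral
of `cosh (s x)` is `ψ (-c s²)`. A real characteristic function forces symmetry, which replaces cosh
by exp. Since `c ≥ 0`, the argument stays in `(-∞, 0]` and continuation reaches every `s`. -/
theorem mgf_of_charFun_comp_sq {ν : Measure ℝ} [IsFiniteMeasure ν] {ψ : ℝ → ℝ} {c : ℝ} (hc : 0 ≤ c)
    (hψ : AnalyticOnNhd ℝ ψ (Set.Iic 0)) (hν : ∀ t, charFun ν t = ψ (c * t ^ 2)) :
    integrableExpSet id ν = Set.univ ∧ ∀ s, mgf id ν s = ψ (-c * s ^ 2) := by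
  obtain ⟨p, hp⟩ := hψ 0 (by simp)
  have hmom := integral_even_pow_of_charFun_comp_sq hp hν
  have hlim : Tendsto (fun t : ℝ => -c * t ^ 2) (𝓝 0) (𝓝 0) := by
    have : Continuous (fun t : ℝ => -c * t ^ 2) := by fun_prop
    simpa using this.tendsto 0
  have hcosh : ∀ᶠ s in 𝓝 (0 : ℝ), Integrable (fun x => Real.cosh (s * x)) ν ∧
      ∫ x, Real.cosh (s * x) ∂ν = ψ (-c * s ^ 2) := by
    filter_upwards [hlim.eventually (hasFPowerSeriesAt_iff.1 hp)] with s hs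
    have := integrable_cosh_mul (ν := ν) (w := fun _ => 1) (h := s) (a := ψ (-c * s ^ 2))
      (fun _ => zero_le_one) (fun n => by simpa using (hmom n).1) ?_
    · simpa using this
    · rw [zero_add] at hs
      convert! hs using 2 with n
      simp only [mul_one, (hmom n).2, smul_eq_mul, mul_pow, ← pow_mul]
      have : ((2 * n).factorial : ℝ) ≠ 0 := by positivity
      field_simp
  have hexp : ∀ s, Integrable (fun x => Real.cosh (s * x)) ν →
      Integrable (fun x => Real.exp (s * x)) ν := fun s hs => by
    refine (hs.const_mul 2).mono' (by fun_prop) (ae_of_all _ fun x => ?_)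
    rw [Real.norm_of_nonneg (Real.exp_pos _).le, Real.cosh_eq]
    have := Real.exp_pos (-(s * x))
    linarith
  have h0 : 0 ∈ interior (integrableExpSet id ν) := by
    rw [mem_interior_iff_mem_nhds]
    filter_upwards [hcosh] with s hs using hexp s hs.1
  have hsymm := map_neg_eq_self_of_charFun_real (f := fun t => ψ (c * t ^ 2)) hν
  have hev : mgf id ν =ᶠ[𝓝 0] fun s => ψ (-c * s ^ 2) := by
    filter_upwards [hcosh] with s hs
    have hi := hexp s hs.1
    have e1 : ∫ x, Real.exp (-(s * x)) ∂ν = ∫ x, Real.exp (s * x) ∂ν := by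
      conv_rhs => rw [← hsymm]
      rw [integral_map (by fun_prop) (by fun_prop)]
      simp
    have hi' : Integrable (fun x => Real.exp (-(s * x))) ν := by
      rw [← hsymm] at hi
      have := (integrable_map_measure (by fun_prop) (by fun_prop)).1 hi
      simpa [Function.comp_def] using this
    rw [← hs.2]
    have : ∀ x, Real.cosh (s * x) = (Real.exp (s * x) + Real.exp (-(s * x))) / 2 :=
      fun x => Real.cosh_eq _
    simp only [this]
    rw [integral_div, integral_add hi hi', e1]
    simp [mgf]
  have hga : ∀ s, AnalyticAt ℝ (fun s => ψ (-c * s ^ 2)) s := fun s => by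
    have h1 : AnalyticAt ℝ ψ (-c * s ^ 2) := hψ _ (by
      simp only [Set.mem_Iic]; nlinarith [mul_nonneg hc (sq_nonneg s)])
    exact h1.comp (f := fun s : ℝ => -c * s ^ 2) (by fun_prop)
  have := integrableExpSet_eq_univ_of_analytic hga h0 hev
  exact ⟨this.1, fun s => congrFun this.2 s⟩

end MomentGenerating

/-! ### Kullback-Leibler duality and exponential tilting -/

section KullbackLeibler

variable {Ω : Type*} [MeasurableSpace Ω] {P F : Measure Ω} {δ : ℝ}

theorem mul_le_mul_log_sub_add_exp {a : ℝ} (ha : 0 ≤ a) (b : ℝ) :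
    a * b ≤ a * Real.log a - a + Real.exp b := by
  rcases ha.eq_or_lt with rfl | ha
  · simpa using (Real.exp_pos b).le
  · have h := Real.add_one_le_exp (b - Real.log a)
    rw [Real.exp_sub, Real.exp_log ha, le_div_iff₀ ha] at h
    nlinarith

theorem ac_integrable_llr_of_mem_klBall (hF : F ∈ klBall P δ) : F ≪ P ∧ Integrable (llr F P) F :=
  InformationTheory.klDiv_ne_top_iff.1 (ne_top_of_le_ne_top ENNReal.ofReal_ne_top hF.2)

theorem integral_llr_le_of_mem_klBall [IsProbabilityMeasure P] (hδ : 0 ≤ δ) (hF : F ∈ klBall P δ) :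
    ∫ x, llr F P x ∂F ≤ δ := by
  have := hF.1
  rw [← InformationTheory.toReal_klDiv_of_measure_eq (ac_integrable_llr_of_mem_klBall hF).1 (by simp)]
  exact ENNReal.toReal_le_of_le_ofReal hδ hF.2

theorem self_mem_klBall [IsProbabilityMeasure P] : P ∈ klBall P δ :=
  ⟨inferInstance, by simp [InformationTheory.klDiv_self]⟩

/-- Young's inequality for `a log a - a` and `exp b`, applied to the density and `|g|`. -/
theorem integrable_of_mem_klBall [IsProbabilityMeasure P] (hF : F ∈ klBall P δ) {g : Ω → ℝ}
    (hg : Measurable g) (hexp : Integrable (fun x => Real.exp |g x|) P) : Integrable g F := by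
  have := hF.1
  obtain ⟨hac, hllr⟩ := ac_integrable_llr_of_mem_klBall hF
  rw [← integrable_rnDeriv_smul_iff hac]
  have h1 := (integrable_rnDeriv_mul_log_iff hac).2 hllr
  have h2 : Integrable (fun x => (F.rnDeriv P x).toReal) P := Measure.integrable_toReal_rnDeriv
  refine ((h1.sub h2).add hexp).mono' (by fun_prop) (ae_of_all _ fun x => ?_)
  rw [smul_eq_mul, norm_mul, Real.norm_of_nonneg ENNReal.toReal_nonneg, Real.norm_eq_abs]
  exact mul_le_mul_log_sub_add_exp ENNReal.toReal_nonneg _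

/-- The Donsker-Varadhan inequality on a Kullback-Leibler ball. -/
theorem integral_le_log_integral_exp_add [IsProbabilityMeasure P] (hδ : 0 ≤ δ)
    (hF : F ∈ klBall P δ) {g : Ω → ℝ} (hg : Integrable g F)
    (hexp : Integrable (fun x => Real.exp (g x)) P) :
    ∫ x, g x ∂F ≤ Real.log (∫ x, Real.exp (g x) ∂P) + δ := by
  have := hF.1
  obtain ⟨hac, hllr⟩ := ac_integrable_llr_of_mem_klBall hF
  have hprob := isProbabilityMeasure_tilted hexp
  have hac' : F ≪ P.tilted g := hac.trans (absolutelyContinuous_tilted hexp)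
  have h1 := InformationTheory.integral_llr_add_sub_measure_univ_nonneg hac'
    (integrable_llr_tilted_right hac hg hllr hexp)
  rw [integral_llr_tilted_right hac hg hexp hllr] at h1
  simp only [probReal_univ] at h1
  linarith [integral_llr_le_of_mem_klBall hδ hF]

theorem llr_tilted_ae_eq [IsProbabilityMeasure P] {g : Ω → ℝ}
    (hexp : Integrable (fun x => Real.exp (g x)) P) :
    llr (P.tilted g) P =ᵐ[P.tilted g] fun x => g x - Real.log (∫ x, Real.exp (g x) ∂P) :=
  (tilted_absolutelyContinuous P g).ae_le (log_rnDeriv_tilted_left_self hexp)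

theorem integral_llr_tilted [IsProbabilityMeasure P] {g : Ω → ℝ}
    (hexp : Integrable (fun x => Real.exp (g x)) P) (hg : Integrable g (P.tilted g)) :
    ∫ x, llr (P.tilted g) P x ∂(P.tilted g)
      = ∫ x, g x ∂(P.tilted g) - Real.log (∫ x, Real.exp (g x) ∂P) := by
  have := isProbabilityMeasure_tilted hexp
  rw [integral_congr_ae (llr_tilted_ae_eq hexp), integral_sub hg (integrable_const _)]
  simp

/-- Nonnegativity of the divergence of the tilted law from `P`. -/
theorem log_integral_exp_le_integral_tilted [IsProbabilityMeasure P] {g : Ω → ℝ}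
    (hexp : Integrable (fun x => Real.exp (g x)) P) (hg : Integrable g (P.tilted g)) :
    Real.log (∫ x, Real.exp (g x) ∂P) ≤ ∫ x, g x ∂(P.tilted g) := by
  have := isProbabilityMeasure_tilted hexp
  have h := InformationTheory.integral_llr_add_sub_measure_univ_nonneg
    (tilted_absolutelyContinuous P g)
    ((integrable_congr (llr_tilted_ae_eq hexp)).2 (hg.sub (integrable_const _)))
  rw [integral_llr_tilted hexp hg] at h
  simp only [probReal_univ] at h
  linarith

theorem tilted_mem_klBall [IsProbabilityMeasure P] {g : Ω → ℝ}
    (hexp : Integrable (fun x => Real.exp (g x)) P) (hg : Integrable g (P.tilted g))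
    (h : ∫ x, g x ∂(P.tilted g) - Real.log (∫ x, Real.exp (g x) ∂P) ≤ δ) :
    P.tilted g ∈ klBall P δ := by
  have hprob := isProbabilityMeasure_tilted hexp
  refine ⟨hprob, ?_⟩
  have hac := tilted_absolutelyContinuous P g
  have hi : Integrable (llr (P.tilted g) P) (P.tilted g) :=
    (integrable_congr (llr_tilted_ae_eq hexp)).2 (hg.sub (integrable_const _))
  rw [InformationTheory.klDiv_of_ac_of_integrable hac hi, integral_llr_tilted hexp hg]
  simp only [probReal_univ]
  exact ENNReal.ofReal_le_ofReal (by linarith)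

section ExponentialMoments

variable [IsProbabilityMeasure P] {Y : Ω → ℝ}

theorem integrable_exp_abs_of_integrableExpSet_eq_univ
    (hYe : integrableExpSet Y P = Set.univ) (s : ℝ) :
    Integrable (fun x => Real.exp |s * Y x|) P := by
  have h : ∀ t, Integrable (fun x => Real.exp (t * Y x)) P := fun t => by
    have : t ∈ integrableExpSet Y P := hYe ▸ Set.mem_univ t
    exact this
  simp_rw [abs_mul]
  by_cases hs : s = 0
  · simp [hs]
  exact integrable_exp_mul_abs (h |s|) (h (-|s|))

theorem integrable_of_mem_klBall_of_integrableExpSet (hY : Measurable Y)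
    (hYe : integrableExpSet Y P = Set.univ) (hF : F ∈ klBall P δ) : Integrable Y F :=
  integrable_of_mem_klBall hF hY (by simpa using integrable_exp_abs_of_integrableExpSet_eq_univ hYe 1)

theorem integral_le_cgf_add_div (hY : Measurable Y)
    (hYe : integrableExpSet Y P = Set.univ) (hδ : 0 ≤ δ) (hF : F ∈ klBall P δ) {s : ℝ} (hs : 0 < s) :
    ∫ x, Y x ∂F ≤ (cgf Y P s + δ) / s := by
  have h : s ∈ integrableExpSet Y P := hYe ▸ Set.mem_univ s
  have h1 := integral_le_log_integral_exp_add hδ hF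
    ((integrable_of_mem_klBall_of_integrableExpSet hY hYe hF).const_mul s) h
  rw [integral_const_mul] at h1
  rw [le_div_iff₀ hs, mul_comm]
  exact h1

/-- The tilt by `s Y` has mean `cgf' s` and divergence `h s = s cgf' s - cgf s`, continuous with `h
0 = 0`. If `h` reaches `δ`, the tilt with `h u = δ` attains the dual bound. Otherwise every tilt
with `s > 0` lies in the ball, and `h ≥ 0` makes it optimal up to `δ / s`, which vanishes as `s →
∞`. -/
theorem exists_mem_klBall_of_pos (hYe : integrableExpSet Y P = Set.univ) (hδ : 0 < δ) :
    (∃ s > 0, ∃ F ∈ klBall P δ, ∫ x, Y x ∂F = (cgf Y P s + δ) / s) ∨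
      ∀ s > 0, ∃ F ∈ klBall P δ, (cgf Y P s + δ) / s ≤ ∫ x, Y x ∂F + δ / s := by
  have hint : ∀ s, s ∈ interior (integrableExpSet Y P) := by simp [hYe]
  have hmem : ∀ s, Integrable (fun x => Real.exp (s * Y x)) P := fun s => by
    have : s ∈ integrableExpSet Y P := interior_subset (hint s)
    exact this
  set h : ℝ → ℝ := fun s => s * deriv (cgf Y P) s - cgf Y P s with hh
  have hcont : Continuous h := by
    have h1 : ∀ s, AnalyticAt ℝ (cgf Y P) s := fun s => analyticAt_cgf (hint s)
    have h2 : Continuous (cgf Y P) := continuous_iff_continuousAt.2 fun s => (h1 s).continuousAt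
    have h3 : Continuous (deriv (cgf Y P)) :=
      continuous_iff_continuousAt.2 fun s => (h1 s).deriv.continuousAt
    fun_prop
  have h0 : h 0 = 0 := by simp [hh]
  have hE : ∀ s, ∫ x, Y x ∂(P.tilted (s * Y ·)) = deriv (cgf Y P) s := fun s =>
    integral_tilted_mul_self (hint s)
  have hgi : ∀ s, Integrable (fun x => s * Y x) (P.tilted (s * Y ·)) := fun s => by
    have := memLp_tilted_mul (hint s) 1
    exact (memLp_one_iff_integrable.1 (by simpa using this)).const_mul s
  have hball : ∀ s, h s ≤ δ → P.tilted (s * Y ·) ∈ klBall P δ := fun s hs => by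
    refine tilted_mem_klBall (hmem s) (hgi s) ?_
    rw [integral_const_mul, hE]
    exact hs
  have hnn : ∀ s, cgf Y P s ≤ s * deriv (cgf Y P) s := fun s => by
    have := log_integral_exp_le_integral_tilted (hmem s) (hgi s)
    rwa [integral_const_mul, hE] at this
  by_cases hex : ∃ s > 0, δ ≤ h s
  · obtain ⟨s, hs, hle⟩ := hex
    obtain ⟨u, hu, hue⟩ := intermediate_value_Icc hs.le hcont.continuousOn
      (show δ ∈ Set.Icc (h 0) (h s) from ⟨by rw [h0]; exact hδ.le, hle⟩)
    have hupos : 0 < u := by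
      rcases hu.1.eq_or_lt with h' | h'
      · rw [← h', h0] at hue; exact absurd hue hδ.ne
      · exact h'
    refine Or.inl ⟨u, hupos, _, hball u hue.le, ?_⟩
    rw [hE, eq_div_iff hupos.ne', ← hue, hh]; ring
  · push Not at hex
    refine Or.inr fun s hs => ⟨_, hball s (hex s hs).le, ?_⟩
    rw [hE, add_div]
    gcongr
    rw [div_le_iff₀ hs, mul_comm]
    exact hnn s

theorem tendsto_cgf_div_nhdsGT_zero (hYe : integrableExpSet Y P = Set.univ) :
    Tendsto (fun s => cgf Y P s / s) (𝓝[>] 0) (𝓝 (∫ x, Y x ∂P)) := by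
  have hint : (0 : ℝ) ∈ interior (integrableExpSet Y P) := by simp [hYe]
  have hd := (analyticAt_cgf hint).differentiableAt.hasDerivAt
  rw [deriv_cgf_zero hint] at hd
  have := hd.tendsto_slope_zero_right
  simpa [div_eq_inv_mul] using this

end ExponentialMoments

end KullbackLeibler

/-! ### Worst-case probability of an event over a K-L ball -/

section Bernoulli

theorem exp_neg_mul_rpow_le_one {δ y x : ℝ} (hδ : 0 ≤ δ) (hy : 0 ≤ y) (hx : x ∈ Set.Ioo (0 : ℝ) 1) :
    Real.exp (-δ) * x ^ y ≤ 1 :=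
  mul_le_one₀ (Real.exp_le_one_iff.2 (by linarith)) (Real.rpow_nonneg hx.1.le _)
    (Real.rpow_le_one hx.1.le hx.2.le hy)

theorem le_perturbed_iff {δ y x a : ℝ} (hx : x ∈ Set.Ioo (0 : ℝ) 1) :
    a ≤ (Real.exp (-δ) * x ^ y - 1) / (x - 1) ↔ a * (1 - x) ≤ 1 - Real.exp (-δ) * x ^ y := by
  rw [← neg_div_neg_eq, le_div_iff₀ (by linarith [hx.2])]
  simp only [neg_sub]

theorem lt_perturbed_iff {δ y x a : ℝ} (hx : x ∈ Set.Ioo (0 : ℝ) 1) :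
    a < (Real.exp (-δ) * x ^ y - 1) / (x - 1) ↔ a * (1 - x) < 1 - Real.exp (-δ) * x ^ y := by
  rw [← neg_div_neg_eq, lt_div_iff₀ (by linarith [hx.2])]
  simp only [neg_sub]

theorem yTilde_le {δ y x : ℝ} (hδ : 0 ≤ δ) (hy : 0 ≤ y) (hx : x ∈ Set.Ioo (0 : ℝ) 1) :
    yTilde δ y ≤ (Real.exp (-δ) * x ^ y - 1) / (x - 1) := by
  refine csInf_le ⟨0, ?_⟩ ⟨x, hx, rfl⟩
  rintro _ ⟨z, hz, rfl⟩
  rw [le_perturbed_iff hz]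
  linarith [exp_neg_mul_rpow_le_one hδ hy hz]

theorem le_yTilde {δ y a : ℝ}
    (h : ∀ x ∈ Set.Ioo (0 : ℝ) 1, a ≤ (Real.exp (-δ) * x ^ y - 1) / (x - 1)) : a ≤ yTilde δ y := by
  refine le_csInf ⟨_, 1 / 2, by norm_num, rfl⟩ ?_
  rintro _ ⟨z, hz, rfl⟩
  exact h z hz

theorem rpow_le_one_sub_mul {x y : ℝ} (hx : 0 < x) (hy : 0 ≤ y) (hy1 : y ≤ 1) :
    x ^ y ≤ 1 - y * (1 - x) := by
  have := rpow_one_add_le_one_add_mul_self (s := x - 1) (by linarith) hy hy1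
  rw [add_sub_cancel] at this
  linarith

theorem self_le_yTilde {δ y : ℝ} (hδ : 0 ≤ δ) (hy : 0 ≤ y) (hy1 : y ≤ 1) : y ≤ yTilde δ y := by
  refine le_yTilde fun x hx => (le_perturbed_iff hx).2 ?_
  have h1 := rpow_le_one_sub_mul hx.1 hy hy1
  have h2 : Real.exp (-δ) * x ^ y ≤ x ^ y :=
    mul_le_of_le_one_left (Real.rpow_nonneg hx.1.le _) (Real.exp_le_one_iff.2 (by linarith))
  linarith

theorem yTilde_le_one {δ y : ℝ} (hδ : 0 ≤ δ) (hy : 0 ≤ y) : yTilde δ y ≤ 1 := by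
  by_contra! h
  set T := yTilde δ y with hT
  -- With this `x`, `T (1 - x) = (T + 1) / 2 > 1`, whereas it can be at most 1.
  have hx : (1 - 1 / T) / 2 ∈ Set.Ioo (0 : ℝ) 1 := by
    have h1 : 1 / T < 1 := by rw [div_lt_one (by linarith)]; exact h
    have h2 : 0 < 1 / T := by positivity
    constructor <;> linarith
  have h1 := (le_perturbed_iff hx).1 (yTilde_le hδ hy hx)
  have h2 : 0 ≤ Real.exp (-δ) * ((1 - 1 / T) / 2) ^ y :=
    mul_nonneg (Real.exp_pos _).le (Real.rpow_nonneg hx.1.le _)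
  have h3 : T * (1 - (1 - 1 / T) / 2) = (T + 1) / 2 := by
    have : T ≠ 0 := by linarith
    field_simp; ring
  rw [← hT, h3] at h1
  linarith

/-- An infimum over the open interval can lose strictness, so a uniform gap `η` is needed. For `x ≤
x₁`, `x ^ y` is small enough to leave room below 1; for `x ≥ x₁`, the difference `x ^ q - x ^ y` is
at least a multiple of `1 - x`, matching the denominator near `x = 1`. -/
theorem lt_yTilde_of_forall_le {δ y p q : ℝ} (hδ : 0 ≤ δ) (hq : 0 ≤ q) (hqy : q < y) (hy1 : y ≤ 1)
    (hp : 0 ≤ p) (hp1 : p < 1)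
    (h : ∀ x ∈ Set.Ioo (0 : ℝ) 1, p ≤ (Real.exp (-δ) * x ^ q - 1) / (x - 1)) : p < yTilde δ y := by
  have hy : 0 < y := hq.trans_lt hqy
  set x₁ : ℝ := ((1 - p) / 2) ^ (1 / y) with hx₁
  have hx₁pos : 0 < x₁ := Real.rpow_pos_of_pos (by linarith) _
  have hx₁y : x₁ ^ y = (1 - p) / 2 := by
    rw [hx₁, ← Real.rpow_mul (by linarith), one_div_mul_cancel hy.ne', Real.rpow_one]
  have hE := Real.exp_pos (-δ)
  have hE1 : Real.exp (-δ) ≤ 1 := Real.exp_le_one_iff.2 (by linarith)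
  set η := min ((1 - p) / 2) (Real.exp (-δ) * (x₁ * (y - q))) with hη
  have hηpos : 0 < η := lt_min (by linarith) (mul_pos hE (mul_pos hx₁pos (by linarith)))
  refine lt_of_lt_of_le (show p < p + η by linarith) (le_yTilde fun x hx => ?_)
  rw [le_perturbed_iff hx]
  have hx0 := hx.1
  have hx1 := hx.2
  rcases le_total x x₁ with hle | hle
  · have h1 : x ^ y ≤ (1 - p) / 2 := hx₁y ▸ Real.rpow_le_rpow hx0.le hle hy.le
    have h2 : Real.exp (-δ) * x ^ y ≤ x ^ y :=
      mul_le_of_le_one_left (Real.rpow_nonneg hx0.le _) hE1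
    have h3 : η ≤ (1 - p) / 2 := min_le_left _ _
    have h4 : 0 ≤ (p + η) * x := by positivity
    linarith
  · have h1 := (le_perturbed_iff hx).1 (h x hx)
    have h2 : x ^ y = x ^ q * x ^ (y - q) := by rw [← Real.rpow_add hx0]; ring_nf
    have h3 : x ^ (y - q) ≤ 1 - (y - q) * (1 - x) :=
      rpow_le_one_sub_mul hx0 (by linarith) (by linarith)
    have h4 : x₁ ≤ x ^ q := hle.trans (by
      simpa using Real.rpow_le_rpow_of_exponent_ge hx0 hx1.le (by linarith : q ≤ 1))
    have h5 : x₁ * (y - q) * (1 - x) ≤ x ^ q - x ^ y := by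
      have h6 : 0 ≤ (y - q) * (1 - x) := mul_nonneg (by linarith) (by linarith)
      rw [h2]
      nlinarith [mul_le_mul_of_nonneg_right h4 h6,
        mul_le_mul_of_nonneg_left h3 (hx₁pos.le.trans h4)]
    have h7 : η ≤ Real.exp (-δ) * (x₁ * (y - q)) := min_le_right _ _
    have h8 := mul_le_mul_of_nonneg_right h7 (by linarith : 0 ≤ 1 - x)
    have h9 := mul_le_mul_of_nonneg_left h5 hE.le
    linarith

theorem yTilde_zero_le_self (y : ℝ) (hy : 0 ≤ y) : yTilde 0 y ≤ y := by
  have hd : HasDerivAt (fun x : ℝ => x ^ y) y 1 := by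
    simpa using Real.hasDerivAt_rpow_const (x := 1) (p := y) (Or.inl one_ne_zero)
  have ht := (hasDerivAt_iff_tendsto_slope.1 hd).mono_left
    (nhdsWithin_mono (1 : ℝ) (show Set.Iio (1 : ℝ) ⊆ {1}ᶜ from fun x hx => ne_of_lt hx))
  refine ge_of_tendsto ht ?_
  filter_upwards [Ioo_mem_nhdsLT (zero_lt_one' ℝ)] with x hx
  have := yTilde_le le_rfl hy hx
  simpa [slope_def_field] using this

theorem exp_indicator_log {Ω : Type*} {A : Set Ω} {x : ℝ} (hx : 0 < x) (ω : Ω) :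
    Real.exp (A.indicator (fun _ => Real.log x) ω) = 1 + A.indicator (fun _ => x - 1) ω := by
  by_cases h : ω ∈ A <;> simp [h, Real.exp_log hx]

variable {Ω : Type*} [MeasurableSpace Ω] {P F : Measure Ω} {δ : ℝ} {A : Set Ω}

theorem integrable_indicator_const [IsFiniteMeasure P] (hA : MeasurableSet A) (c : ℝ) :
    Integrable (A.indicator fun _ => c) P := (integrable_const c).indicator hA

theorem integrable_exp_indicator_log [IsFiniteMeasure P] (hA : MeasurableSet A) {x : ℝ}
    (hx : 0 < x) : Integrable (fun ω => Real.exp (A.indicator (fun _ => Real.log x) ω)) P := by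
  simp_rw [exp_indicator_log hx]
  exact (integrable_const _).add (integrable_indicator_const hA _)

theorem integral_exp_indicator_log [IsProbabilityMeasure P] (hA : MeasurableSet A) {x : ℝ}
    (hx : 0 < x) : ∫ ω, Real.exp (A.indicator (fun _ => Real.log x) ω) ∂P
      = 1 - P.real A * (1 - x) := by
  simp_rw [exp_indicator_log hx]
  rw [integral_add (integrable_const _) (integrable_indicator_const hA _),
    integral_indicator_const _ hA]
  simp; ring

/-- Donsker-Varadhan for `log x` times the indicator of `A`, exponentiated. -/
theorem measureReal_le_perturbed [IsProbabilityMeasure P] (hδ : 0 ≤ δ) (hF : F ∈ klBall P δ)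
    (hA : MeasurableSet A) {x : ℝ} (hx : x ∈ Set.Ioo (0 : ℝ) 1) :
    P.real A ≤ (Real.exp (-δ) * x ^ F.real A - 1) / (x - 1) := by
  have := hF.1
  have hZ : 0 < 1 - P.real A * (1 - x) := by
    have := measureReal_le_one (μ := P) (s := A)
    have h1 : P.real A * (1 - x) ≤ 1 * (1 - x) :=
      mul_le_mul_of_nonneg_right this (by linarith [hx.2])
    linarith [hx.1]
  have h := integral_le_log_integral_exp_add hδ hF (integrable_indicator_const hA (Real.log x))
    (integrable_exp_indicator_log hA hx.1)
  rw [integral_exp_indicator_log hA hx.1, integral_indicator_const _ hA, smul_eq_mul] at h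
  rw [le_perturbed_iff hx]
  have h2 : Real.exp (-δ) * x ^ F.real A ≤ 1 - P.real A * (1 - x) := by
    rw [Real.rpow_def_of_pos hx.1, ← Real.exp_add, ← Real.le_log_iff_exp_le hZ]
    linarith
  linarith

theorem le_measureReal_of_yTilde_le [IsProbabilityMeasure P] (hδ : 0 ≤ δ) (hA : MeasurableSet A)
    {y : ℝ} (hy1 : y ≤ 1) (h : yTilde δ y ≤ P.real A) (hF : F ∈ klBall P δ) : y ≤ F.real A := by
  have := hF.1
  by_contra! hlt
  rcases (measureReal_le_one (μ := P) (s := A)).lt_or_eq with hp | hp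
  · exact absurd (lt_yTilde_of_forall_le hδ measureReal_nonneg hlt hy1 measureReal_nonneg hp
      fun x hx => measureReal_le_perturbed hδ hF hA hx) (not_lt.2 h)
  -- If `P(A) = 1` no strict gap is available; absolute continuity forces `F(A) = 1` instead.
  · have h1 : P Aᶜ = 0 := by
      rw [← measureReal_eq_zero_iff, probReal_compl_eq_one_sub hA, hp, sub_self]
    have h2 : F Aᶜ = 0 := (ac_integrable_llr_of_mem_klBall hF).1 h1
    rw [← measureReal_eq_zero_iff, probReal_compl_eq_one_sub hA] at h2
    linarith

theorem measureReal_tilted_indicator_log [IsProbabilityMeasure P] (hA : MeasurableSet A) {x : ℝ}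
    (hx : 0 < x) : (P.tilted (A.indicator fun _ => Real.log x)).real A
      = P.real A * x / (1 - P.real A * (1 - x)) := by
  have h := integral_tilted (μ := P) (A.indicator fun _ => Real.log x) (A.indicator fun _ => (1 : ℝ))
  rw [integral_indicator_const _ hA, smul_eq_mul, mul_one] at h
  rw [h, integral_exp_indicator_log hA hx]
  have : ∀ ω, (Real.exp (A.indicator (fun _ => Real.log x) ω) / (1 - P.real A * (1 - x))) •
      A.indicator (fun _ => (1 : ℝ)) ω
      = A.indicator (fun _ => x / (1 - P.real A * (1 - x))) ω := fun ω => by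
    by_cases hω : ω ∈ A <;> simp [hω, Real.exp_log hx]
  simp_rw [this]
  rw [integral_indicator_const _ hA, smul_eq_mul, mul_div_assoc]

/-- Unless `P` itself works, tilting `A` by a factor `z ≤ 1` gives it mass exactly `y`, and the
ratio defining `yTilde` at `z` says that this costs divergence less than `δ`. By continuity a
slightly smaller factor stays in the ball and pushes the mass below `y`. -/
theorem exists_mem_klBall_measureReal_lt [IsProbabilityMeasure P] (hδ : 0 ≤ δ) (hA : MeasurableSet A)
    {y : ℝ} (hy : 0 < y) (h : P.real A < yTilde δ y) : ∃ F ∈ klBall P δ, F.real A < y := by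
  rcases lt_or_ge (P.real A) y with hlt | hge
  · exact ⟨P, self_mem_klBall, hlt⟩
  set p := P.real A with hp
  have hp1 : p < 1 := h.trans_le (yTilde_le_one hδ hy.le)
  have hp0 : 0 < p := hy.trans_le hge
  have hy1 : y < 1 := hge.trans_lt hp1
  -- The odds of `y` divided by the odds of `p`.
  set z := y * (1 - p) / (p * (1 - y)) with hz
  have hden : 0 < p * (1 - y) := mul_pos hp0 (by linarith)
  have hzpos : 0 < z := div_pos (mul_pos hy (by linarith)) hden
  have hz1 : z ≤ 1 := by rw [hz, div_le_one hden]; linarith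
  have hZ : ∀ x, 0 < x → 0 < 1 - p * (1 - x) := fun x hx => by nlinarith [mul_pos hp0 hx]
  set k : ℝ → ℝ := fun x =>
    p * x / (1 - p * (1 - x)) * Real.log x - Real.log (1 - p * (1 - x)) with hk
  have hqz : p * z / (1 - p * (1 - z)) = y := by
    rw [div_eq_iff (hZ z hzpos).ne']
    have : p * (1 - y) * z = y * (1 - p) := by
      have : 1 - y ≠ 0 := by linarith
      rw [hz]; field_simp
    linarith
  have hkz : k z < δ := by
    simp only [hk, hqz]
    rcases hz1.lt_or_eq with hzlt | hzeq
    · have h1 := (lt_perturbed_iff ⟨hzpos, hzlt⟩).1 (h.trans_le (yTilde_le hδ hy.le ⟨hzpos, hzlt⟩))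
      have h2 : Real.exp (-δ) * z ^ y < 1 - p * (1 - z) := by linarith
      rw [Real.rpow_def_of_pos hzpos, ← Real.exp_add, ← Real.lt_log_iff_exp_lt (hZ z hzpos)] at h2
      linarith
    -- Here `z = 1` and the tilt is trivial, so only `δ = 0` could fail; then `yTilde 0 y ≤ y = p`
    -- contradicts `h`.
    · have hpy : p = y := by rw [hzeq] at hqz; simpa using hqz
      rcases hδ.lt_or_eq with hδ' | hδ'
      · simpa [hzeq] using hδ'
      · rw [← hδ', hpy] at h
        exact absurd h (not_lt.2 (yTilde_zero_le_self y hy.le))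
  have hcont : ContinuousAt k z := by
    have h1 : 1 - p * (1 - z) ≠ 0 := (hZ z hzpos).ne'
    have h2 : z ≠ 0 := hzpos.ne'
    simp only [hk]
    fun_prop (disch := assumption)
  have hev : ∀ᶠ x in 𝓝[<] z, k x < δ := (hcont.eventually_lt_const hkz).filter_mono nhdsWithin_le_nhds
  obtain ⟨x, hkx, hx⟩ := (hev.and (Ioo_mem_nhdsLT hzpos)).exists
  refine ⟨_, tilted_mem_klBall (g := A.indicator fun _ => Real.log x)
    (integrable_exp_indicator_log hA hx.1) ?_ ?_, ?_⟩
  · have := isProbabilityMeasure_tilted (integrable_exp_indicator_log (P := P) hA hx.1)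
    exact integrable_indicator_const hA _
  · rw [integral_indicator_const _ hA, measureReal_tilted_indicator_log hA hx.1,
      integral_exp_indicator_log hA hx.1, smul_eq_mul]
    exact hkx.le
  · rw [measureReal_tilted_indicator_log hA hx.1, div_lt_iff₀ (hZ x hx.1)]
    have := hx.2
    rw [hz, lt_div_iff₀ hden] at this
    linarith

end Bernoulli

/-! ### Projections of elliptical laws and quantiles -/

section Elliptical

section Laws

variable {ι : Type*} [Fintype ι] {P : Measure (EuclideanSpace ℝ ι)} {m : EuclideanSpace ℝ ι}
  {Q : Matrix ι ι ℝ} {ψ : ℝ → ℝ}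

theorem dot_eq_inner (a b : EuclideanSpace ℝ ι) : dot a b = inner ℝ b a := by
  simp [dot, PiLp.inner_apply]

theorem measurable_dot (a : EuclideanSpace ℝ ι) : Measurable (dot a) := by
  unfold dot; fun_prop

theorem dot_smul_left (t : ℝ) (a b : EuclideanSpace ℝ ι) : dot (t • a) b = t * dot a b := by
  simp [dot, Finset.mul_sum, mul_assoc]

theorem quad_smul (Q : Matrix ι ι ℝ) (t : ℝ) (a : EuclideanSpace ℝ ι) :
    quad Q (t • a) = t ^ 2 * quad Q a := by
  simp only [quad, Finset.mul_sum, PiLp.smul_apply, smul_eq_mul]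
  refine Finset.sum_congr rfl fun i _ => Finset.sum_congr rfl fun j _ => by ring

theorem quad_eq_dotProduct (Q : Matrix ι ι ℝ) (a : EuclideanSpace ℝ ι) :
    quad Q a = star (a : ι → ℝ) ⬝ᵥ (Q *ᵥ (a : ι → ℝ)) := by
  simp [quad, dotProduct, Matrix.mulVec, Finset.mul_sum, mul_assoc]

theorem quad_nonneg (hQ : Q.PosSemidef) (a : EuclideanSpace ℝ ι) : 0 ≤ quad Q a := by
  rw [quad_eq_dotProduct]; exact hQ.dotProduct_mulVec_nonneg _

theorem IsElliptical.charFun_map_dot (hP : IsElliptical P m Q ψ) (a : EuclideanSpace ℝ ι) (t : ℝ) :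
    charFun (P.map (dot a)) t
      = Complex.exp ((t * dot a m : ℝ) * Complex.I) * (ψ (t ^ 2 * quad Q a / 2) : ℂ) := by
  have h := hP.charFun_eq (t • a)
  rw [dot_smul_left, quad_smul] at h
  rw [← h, charFun_apply_real, charFun_apply,
    integral_map (measurable_dot a).aemeasurable (by fun_prop)]
  refine integral_congr_ae (ae_of_all _ fun x => ?_)
  simp only [dot_eq_inner, inner_smul_right]
  push_cast; rfl

theorem IsElliptical.map_dot_eq (hP : IsElliptical P m Q ψ) {ν : Measure ℝ}
    (hν : IsStdElliptical ν ψ) (a : EuclideanSpace ℝ ι) :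
    P.map (dot a) = ν.map (fun z => dot a m + Real.sqrt (quad Q a) * z) := by
  have := hP.isProb
  have := hν.isProb
  refine Measure.ext_of_charFun (funext fun t => ?_)
  rw [hP.charFun_map_dot]
  have h1 : ν.map (fun z => dot a m + Real.sqrt (quad Q a) * z)
      = (ν.map (fun z => Real.sqrt (quad Q a) * z)).map (fun z => dot a m + z) := by
    rw [Measure.map_map (by fun_prop) (by fun_prop)]; rfl
  rw [h1, charFun_map_const_add, charFun_map_mul, hν.charFun_eq, mul_pow,
    Real.sq_sqrt (quad_nonneg hP.posSemidef a), mul_comm (quad Q a), mul_comm]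
  simp

/-- Centring removes the phase of the characteristic function, leaving the real form `ψ (c t²)`. -/
theorem IsElliptical.mgf_neg_dot (hP : IsElliptical P m Q ψ)
    (hψ : AnalyticOnNhd ℝ ψ (Set.Iic 0)) (a : EuclideanSpace ℝ ι) :
    integrableExpSet (fun r => dot a m - dot a r) P = Set.univ ∧
      ∀ s, mgf (fun r => dot a m - dot a r) P s = ψ (-(quad Q a) / 2 * s ^ 2) := by
  have := hP.isProb
  set Y : EuclideanSpace ℝ ι → ℝ := fun r => dot a m - dot a r with hY
  have hYm : Measurable Y := (measurable_const).sub (measurable_dot a)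
  have hchar : ∀ t, charFun (P.map Y) t = ψ (quad Q a / 2 * t ^ 2) := fun t => by
    have h1 : P.map Y = ((P.map (dot a)).map (fun z => (-1) * z)).map (fun z => dot a m + z) := by
      rw [Measure.map_map (by fun_prop) (by fun_prop),
        Measure.map_map (by fun_prop) (measurable_dot a)]
      congr 1; funext r; simp [hY, sub_eq_add_neg]
    rw [h1, charFun_map_const_add, charFun_map_mul, hP.charFun_map_dot]
    have h2 : (-1 * t) ^ 2 * quad Q a / 2 = quad Q a / 2 * t ^ 2 := by ring
    rw [h2, mul_right_comm, ← Complex.exp_add]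
    have h3 : ((-1 * t * dot a m : ℝ) : ℂ) * Complex.I + (inner ℝ (dot a m) t : ℝ) * Complex.I = 0 := by
      simp
    rw [h3, Complex.exp_zero, one_mul]
  have h := mgf_of_charFun_comp_sq (div_nonneg (quad_nonneg hP.posSemidef a) zero_le_two) hψ hchar
  refine ⟨?_, fun s => ?_⟩
  · rw [← h.1]
    ext s
    simp only [integrableExpSet, Set.mem_ofPred_eq]
    rw [integrable_map_measure (by simp only [id]; fun_prop) hYm.aemeasurable]
    rfl
  · rw [← mgf_id_map hYm.aemeasurable, h.2, neg_div]

end Laws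

theorem le_add_mul_iff {ξ m σ : ℝ} (hσ : 0 < σ) (X : EReal) :
    (ξ : EReal) ≤ m + X * σ ↔ (((ξ - m) / σ : ℝ) : EReal) ≤ X := by
  induction X with
  | bot => simp [EReal.bot_mul_coe_of_pos hσ]
  | top => simp [EReal.top_mul_coe_of_pos hσ]
  | coe x =>
    norm_cast
    rw [div_le_iff₀ hσ, sub_le_iff_le_add']

/-- With the supremum convention the quantile tests the left limit of the distribution function,
whose complement is the probability of a closed half-line. This makes the constraint exact even when
`ν` has atoms. -/
theorem coe_le_cdfInv_iff {ν : Measure ℝ} [IsProbabilityMeasure ν] {c p : ℝ} :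
    (c : EReal) ≤ cdfInv ν p ↔ ν.real (Set.Iio c) ≤ p := by
  constructor
  · intro h
    have hz : ∀ z < c, cdf ν z ≤ p := fun z hz => by
      have : (z : EReal) < cdfInv ν p := lt_of_lt_of_le (by exact_mod_cast hz) h
      simp only [cdfInv, lt_iSup_iff] at this
      obtain ⟨w, hw, hzw⟩ := this
      exact (monotone_cdf ν (by exact_mod_cast hzw.le)).trans hw
    have hu : Set.Iio c = ⋃ n : ℕ, Set.Iic (c - 1 / ((n : ℝ) + 1)) := by
      refine (iUnion_Iic_eq_Iio_of_lt_of_tendsto (F := atTop) (fun n => ?_) ?_).symm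
      · have : (0 : ℝ) < 1 / ((n : ℝ) + 1) := by positivity
        linarith
      · simpa using (tendsto_one_div_add_atTop_nhds_zero_nat (𝕜 := ℝ)).const_sub c
    have hp : 0 ≤ p := (cdf_nonneg ν (c - 1)).trans (hz _ (by linarith))
    have hmono : Monotone fun n : ℕ => Set.Iic (c - 1 / ((n : ℝ) + 1)) := fun a b hab => by
      refine Set.Iic_subset_Iic.2 (sub_le_sub_left ?_ _)
      gcongr
    refine ENNReal.toReal_le_of_le_ofReal hp ?_
    rw [hu, hmono.measure_iUnion]
    refine iSup_le fun n => ?_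
    rw [← ofReal_cdf]
    refine ENNReal.ofReal_le_ofReal (hz _ ?_)
    have : (0 : ℝ) < 1 / ((n : ℝ) + 1) := by positivity
    linarith
  · intro h
    refine le_of_forall_lt fun a ha => ?_
    obtain ⟨z, haz, hzc⟩ := EReal.lt_iff_exists_real_btwn.1 ha
    refine lt_of_lt_of_le haz ?_
    refine le_iSup₂_of_le z ?_ le_rfl
    rw [cdf_eq_real]
    refine (measureReal_mono fun x hx => ?_).trans h
    exact lt_of_le_of_lt hx (by exact_mod_cast hzc)

theorem IsElliptical.le_measureReal_iff {ι : Type*} [Fintype ι] {P : Measure (EuclideanSpace ℝ ι)}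
    {m : EuclideanSpace ℝ ι} {Q : Matrix ι ι ℝ} {ψ : ℝ → ℝ} (hP : IsElliptical P m Q ψ)
    {ν : Measure ℝ} (hν : IsStdElliptical ν ψ) (a : EuclideanSpace ℝ ι) (ξ : ℝ) {y : ℝ}
    (hy : 0 < y) (hy1 : y ≤ 1) :
    y ≤ P.real {r | ξ ≤ dot a r} ↔
      (ξ : EReal) ≤ (dot a m : EReal) + cdfInv ν (1 - y) * (Real.sqrt (quad Q a) : EReal) := by
  have := hP.isProb
  have := hν.isProb
  have h1 : P.real {r | ξ ≤ dot a r}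
      = ν.real {z | ξ ≤ dot a m + Real.sqrt (quad Q a) * z} := by
    have h2 : (P.map (dot a)).real (Set.Ici ξ)
        = (ν.map (fun z => dot a m + Real.sqrt (quad Q a) * z)).real (Set.Ici ξ) := by
      rw [hP.map_dot_eq hν a]
    rw [map_measureReal_apply (measurable_dot a) measurableSet_Ici,
      map_measureReal_apply (by fun_prop) measurableSet_Ici] at h2
    exact h2
  rw [h1]
  rcases (Real.sqrt_nonneg (quad Q a)).eq_or_lt with h0 | h0
  -- Zero dispersion: the probability is 0 or 1, decided by `0 < y ≤ 1`, and `0 * ±∞ = 0` removes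
  -- the quantile.
  · rw [← h0]
    simp only [zero_mul, add_zero, EReal.coe_zero, mul_zero, EReal.coe_le_coe_iff]
    by_cases hξ : ξ ≤ dot a m
    · simpa [hξ] using hy1
    · simpa [hξ] using hy
  · rw [le_add_mul_iff h0, coe_le_cdfInv_iff]
    have h3 : {z | ξ ≤ dot a m + Real.sqrt (quad Q a) * z}
        = (Set.Iio ((ξ - dot a m) / Real.sqrt (quad Q a)))ᶜ := by
      ext z
      simp only [Set.mem_ofPred_eq, Set.mem_compl_iff, Set.mem_Iio, not_lt]
      rw [div_le_iff₀ h0, sub_le_iff_le_add', mul_comm z]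
    rw [h3, probReal_compl_eq_one_sub measurableSet_Iio]
    constructor <;> intro h <;> linarith

end Elliptical

/-! ### Matching objectives and feasible sets -/

section Reformulation

/-- The order-reversing bijection `x ↦ -(c x)` of `[-∞, ∞]` for `c > 0`. -/
noncomputable def negMulIso {c : ℝ} (hc : 0 < c) : EReal ≃o ERealᵒᵈ where
  toFun x := OrderDual.toDual (-((c : EReal) * x))
  invFun y := ((c⁻¹ : ℝ) : EReal) * -(OrderDual.ofDual y)
  left_inv x := by
    have hc' : 0 < c⁻¹ := inv_pos.2 hc
    induction x with
    | bot => simp [EReal.coe_mul_bot_of_pos, hc, hc']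
    | top => simp [EReal.coe_mul_top_of_pos, hc, hc']
    | coe x =>
      simp only [OrderDual.ofDual_toDual, neg_neg]
      norm_cast
      field_simp
  right_inv y := by
    have hc' : 0 < c⁻¹ := inv_pos.2 hc
    induction y using OrderDual.rec with
    | toDual y =>
    induction y with
    | bot => simp [EReal.coe_mul_top_of_pos, hc, hc']
    | top => simp [EReal.coe_mul_bot_of_pos, hc, hc']
    | coe x =>
      simp only [OrderDual.ofDual_toDual]
      norm_cast
      field_simp
  map_rel_iff' {x y} := by
    change -((c : EReal) * y) ≤ -((c : EReal) * x) ↔ x ≤ y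
    rw [EReal.neg_le_neg_iff]
    induction x with
    | bot => simp [EReal.coe_mul_bot_of_pos hc]
    | top =>
      induction y with
      | bot => simp [EReal.coe_mul_bot_of_pos hc, EReal.coe_mul_top_of_pos hc]
      | top => simp
      | coe y => simp [EReal.coe_mul_top_of_pos hc, ← EReal.coe_mul]
    | coe x =>
      induction y with
      | bot => simp [EReal.coe_mul_bot_of_pos hc, ← EReal.coe_mul]
      | top => simp [EReal.coe_mul_top_of_pos hc]
      | coe y =>
        norm_cast
        exact mul_le_mul_iff_right₀ hc

/-- An order-reversing bijection of `[-∞, ∞]` exchanges all suprema and infima, including those over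
empty sets or with infinite values. -/
theorem neg_mul_iSup₂ {c : ℝ} (hc : 0 < c) {ι : Type*} (s : Set ι) (f : ι → EReal) :
    -((c : EReal) * ⨆ i ∈ s, f i) = ⨅ i ∈ s, -((c : EReal) * f i) :=
  (negMulIso hc).map_iSup₂ (fun i (_ : i ∈ s) => f i)

theorem neg_mul_iInf₂ {c : ℝ} (hc : 0 < c) {ι : Type*} (s : Set ι) (f : ι → EReal) :
    -((c : EReal) * ⨅ i ∈ s, f i) = ⨆ i ∈ s, -((c : EReal) * f i) :=
  (negMulIso hc).map_iInf₂ (fun i (_ : i ∈ s) => f i)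

theorem neg_mul_le_neg_mul_iff {c : ℝ} (hc : 0 < c) {x y : EReal} :
    -((c : EReal) * y) ≤ -((c : EReal) * x) ↔ x ≤ y :=
  (negMulIso hc).map_rel_iff'

variable {S A : Type*} [Fintype S] {K : ℕ} {J : JointProblem S A K} {D : EllipticalData J}

section Objective

variable (hδ₀ : 0 ≤ J.δ₀) (hP₀ : IsElliptical J.P₀ D.μ₀ D.Q₀ D.ψ₀)
  (hψ₀ : AnalyticOnNhd ℝ D.ψ₀ (Set.Iic 0))

/-- The worst-case value `sup_F E_F[-τᵀ r₀]` over the ambiguity set. -/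
noncomputable def worstLoss (J : JointProblem S A K) (τ : J.Vec) : EReal :=
  ⨆ F ∈ J.amb₀, ((-∫ r, dot τ r ∂F : ℝ) : EReal)

theorem objective_eq_neg_mul_worstLoss (τ : J.Vec) :
    J.objective τ = -(((1 / (1 - J.β) : ℝ) : EReal) * worstLoss J τ) := by
  have hc : 0 < 1 / (1 - J.β) := one_div_pos.2 (sub_pos.2 J.β_lt_one)
  rw [worstLoss, neg_mul_iSup₂ hc]
  refine iInf_congr fun F => iInf_congr fun _ => ?_
  norm_cast
  ring

include hψ₀ hP₀ in
theorem integrable_dot_of_mem_amb₀ (τ : J.Vec) {F : Measure J.Vec} (hF : F ∈ J.amb₀) :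
    Integrable (fun r => dot τ r) F := by
  have := hP₀.isProb
  have := hF.1
  have h := integrable_of_mem_klBall_of_integrableExpSet
    (measurable_const.sub (measurable_dot τ)) (hP₀.mgf_neg_dot hψ₀ τ).1 hF
  refine ((integrable_const (dot τ D.μ₀)).sub h).congr (ae_of_all _ fun r => ?_)
  simp

include hψ₀ hP₀ in
theorem integral_sub_dot (τ : J.Vec) {F : Measure J.Vec} (hF : F ∈ J.amb₀) :
    ∫ r, (dot τ D.μ₀ - dot τ r) ∂F = dot τ D.μ₀ - ∫ r, dot τ r ∂F := by
  have := hF.1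
  rw [integral_sub (integrable_const _) (integrable_dot_of_mem_amb₀ hP₀ hψ₀ τ hF)]
  simp

include hψ₀ hP₀ in
theorem objectivePos_one_div (τ : J.Vec) {s : ℝ} (hs : 0 < s) :
    D.objectivePos τ (1 / s)
      = -dot τ D.μ₀ + (cgf (fun r => dot τ D.μ₀ - dot τ r) J.P₀ s + J.δ₀) / s := by
  rw [EllipticalData.objectivePos, cgf, (hP₀.mgf_neg_dot hψ₀ τ).2]
  have : -(quad D.Q₀ τ) / (2 * (1 / s) ^ 2) = -(quad D.Q₀ τ) / 2 * s ^ 2 := by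
    field_simp
  rw [this]; ring

include hδ₀ hψ₀ hP₀ in
theorem neg_integral_le_objectivePos (τ : J.Vec) {F : Measure J.Vec} (hF : F ∈ J.amb₀) {a : ℝ}
    (ha : 0 < a) : -∫ r, dot τ r ∂F ≤ D.objectivePos τ a := by
  have := hP₀.isProb
  have h1 := integral_le_cgf_add_div (Y := fun r => dot τ D.μ₀ - dot τ r) (measurable_const.sub (measurable_dot τ))
    (hP₀.mgf_neg_dot hψ₀ τ).1 hδ₀ hF (one_div_pos.2 ha)
  have h2 := objectivePos_one_div hP₀ hψ₀ τ (one_div_pos.2 ha)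
  rw [one_div_one_div] at h2
  have h3 := integral_sub_dot hP₀ hψ₀ τ hF
  rw [h2]
  linarith

include hδ₀ hψ₀ hP₀ in
theorem worstLoss_le_objective (τ : J.Vec) (a : ℝ) : worstLoss J τ ≤ D.objective τ a := by
  refine iSup₂_le fun F hF => ?_
  unfold EllipticalData.objective
  split_ifs with ha
  · exact_mod_cast neg_integral_le_objectivePos hδ₀ hP₀ hψ₀ τ hF ha
  · refine le_limsup_of_frequently_le' (Eventually.frequently ?_)
    filter_upwards [self_mem_nhdsWithin] with a ha
    exact_mod_cast neg_integral_le_objectivePos hδ₀ hP₀ hψ₀ τ hF ha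

include hψ₀ hP₀ in
-- An attained dual bound at tilt `s` gives `α = 1 / s`; otherwise the excess at `α = a` is at most
-- `δ₀ a`, so the limsup at `α = 0` closes the gap.
theorem exists_objective_le_worstLoss (hδ₀ : 0 < J.δ₀) (τ : J.Vec) :
    ∃ a, 0 ≤ a ∧ D.objective τ a ≤ worstLoss J τ := by
  have := hP₀.isProb
  rcases exists_mem_klBall_of_pos (P := J.P₀) (hP₀.mgf_neg_dot hψ₀ τ).1 hδ₀ with
    ⟨s, hs, F, hF, h⟩ | h
  · refine ⟨1 / s, (one_div_pos.2 hs).le, ?_⟩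
    have h1 : D.objectivePos τ (1 / s) = -∫ r, dot τ r ∂F := by
      rw [objectivePos_one_div hP₀ hψ₀ τ hs, ← h, integral_sub_dot hP₀ hψ₀ τ hF]; ring
    unfold EllipticalData.objective
    rw [if_pos (one_div_pos.2 hs), h1]
    exact le_iSup₂_of_le F hF le_rfl
  · refine ⟨0, le_rfl, ?_⟩
    unfold EllipticalData.objective
    rw [if_neg (lt_irrefl _)]
    have hP : J.P₀ ∈ J.amb₀ := self_mem_klBall
    have hge : ((-∫ r, dot τ r ∂J.P₀ : ℝ) : EReal) ≤ worstLoss J τ := le_iSup₂_of_le _ hP le_rfl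
    have hle : ∀ F ∈ J.amb₀, ((-∫ r, dot τ r ∂F : ℝ) : EReal) ≤ worstLoss J τ :=
      fun F hF => le_iSup₂_of_le F hF le_rfl
    generalize worstLoss J τ = W at hge hle
    induction W with
    | bot => simp at hge
    | top => exact le_top
    | coe w =>
      have hbd : ∀ a > 0, D.objectivePos τ a ≤ w + J.δ₀ * a := fun a ha => by
        obtain ⟨F, hF, hle'⟩ := h (1 / a) (one_div_pos.2 ha)
        have h2 := objectivePos_one_div hP₀ hψ₀ τ (one_div_pos.2 ha)
        rw [one_div_one_div] at h2
        rw [integral_sub_dot hP₀ hψ₀ τ hF, div_div_eq_mul_div, div_one] at hle'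
        have h3 : -∫ r, dot τ r ∂F ≤ w := by exact_mod_cast hle F hF
        rw [h2]
        simp only [div_div_eq_mul_div, div_one] at *
        linarith
      have ht : Tendsto (fun a : ℝ => ((w + J.δ₀ * a : ℝ) : EReal)) (𝓝[>] 0) (𝓝 (w : EReal)) := by
        refine (continuous_coe_real_ereal.tendsto w).comp ?_
        have : Continuous fun a : ℝ => w + J.δ₀ * a := by fun_prop
        simpa using (this.tendsto 0).mono_left nhdsWithin_le_nhds
      rw [← ht.limsup_eq]
      refine limsup_le_limsup ?_
      filter_upwards [self_mem_nhdsWithin] with a ha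
      exact_mod_cast hbd a ha

include hδ₀ hψ₀ hP₀ in
theorem iInf_objective_eq_worstLoss (τ : J.Vec) :
    ⨅ a ∈ Set.Ici (0 : ℝ), D.objective τ a = worstLoss J τ := by
  refine le_antisymm ?_ (le_iInf₂ fun a _ => worstLoss_le_objective hδ₀ hP₀ hψ₀ τ a)
  have := hP₀.isProb
  rcases hδ₀.lt_or_eq with hpos | hzero
  · obtain ⟨a, ha, hle⟩ := exists_objective_le_worstLoss hP₀ hψ₀ hpos τ
    exact (iInf₂_le a ha).trans hle
  -- For `δ₀ = 0` the infimum is approached as `α = 1 / s → ∞`, where `cgf s / s` tends to the mean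
  -- under `P₀`. This yields no minimizing `α`.
  · have hP : J.P₀ ∈ J.amb₀ := self_mem_klBall
    refine le_trans ?_ (le_iSup₂_of_le J.P₀ hP le_rfl)
    have ht := (tendsto_cgf_div_nhdsGT_zero (P := J.P₀) (hP₀.mgf_neg_dot hψ₀ τ).1).const_add
      (-dot τ D.μ₀)
    rw [integral_sub_dot hP₀ hψ₀ τ hP, neg_add_eq_sub, sub_sub_cancel_left] at ht
    refine ge_of_tendsto ((continuous_coe_real_ereal.tendsto _).comp ht) ?_
    filter_upwards [self_mem_nhdsWithin] with s hs
    refine (iInf₂_le (1 / s) (one_div_pos.2 hs).le).trans ?_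
    unfold EllipticalData.objective
    rw [if_pos (one_div_pos.2 hs), objectivePos_one_div hP₀ hψ₀ τ hs, ← hzero, add_zero]
    rfl

end Objective

section Feasibility

theorem mem_feasible_iff (hP : ∀ k, IsProbabilityMeasure (J.P k)) (τ : J.Vec) :
    τ ∈ J.feasible ↔ τ ∈ J.occupation ∧ ∃ y : Fin K → ℝ, (∀ k, 0 ≤ y k ∧ y k ≤ 1) ∧
      J.ε ≤ ∏ k, y k ∧ ∀ k, ∀ F ∈ klBall (J.P k) (J.δ k), y k ≤ F.real {r | J.ξ k ≤ dot τ r} := by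
  have key : (ENNReal.ofReal J.ε ≤ ⨅ F ∈ J.amb, F {r | ∀ k, J.ξ k ≤ dot τ (r k)}) ↔
      ∀ G : Fin K → Measure J.Vec, (∀ k, G k ∈ klBall (J.P k) (J.δ k)) →
        J.ε ≤ ∏ k, (G k).real {r | J.ξ k ≤ dot τ r} := by
    have hG : ∀ G : Fin K → Measure J.Vec, (∀ k, G k ∈ klBall (J.P k) (J.δ k)) →
        (ENNReal.ofReal J.ε ≤ Measure.pi G {r | ∀ k, J.ξ k ≤ dot τ (r k)} ↔
          J.ε ≤ ∏ k, (G k).real {r | J.ξ k ≤ dot τ r}) := fun G hG => by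
      have := fun k => (hG k).1
      have hset : {r : Fin K → J.Vec | ∀ k, J.ξ k ≤ dot τ (r k)}
          = Set.univ.pi fun k => {r | J.ξ k ≤ dot τ r} := by
        ext r; simp
      rw [hset, Measure.pi_pi, ENNReal.ofReal_le_iff_le_toReal, ENNReal.toReal_prod]
      · rfl
      · exact ENNReal.prod_ne_top fun k _ => measure_ne_top _ _
    rw [le_iInf₂_iff]
    constructor
    · exact fun h G hGb => (hG G hGb).1 (h _ ⟨G, hGb, rfl⟩)
    · rintro h _ ⟨G, hGb, rfl⟩
      exact (hG G hGb).2 (h G hGb)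
  change (τ ∈ J.occupation ∧ _) ↔ _
  rw [key]
  refine and_congr_right fun _ => ⟨fun h => ?_, ?_⟩
  · set V : Fin K → Set ℝ := fun k =>
      (fun F : Measure J.Vec => F.real {r | J.ξ k ≤ dot τ r}) '' klBall (J.P k) (J.δ k) with hV
    have hself : ∀ k, J.P k ∈ klBall (J.P k) (J.δ k) := fun k => self_mem_klBall
    have hne : ∀ k, (V k).Nonempty := fun k => ⟨_, _, hself k, rfl⟩
    have hbdd : ∀ k, BddBelow (V k) := fun k => ⟨0, by
      rintro _ ⟨F, _, rfl⟩; exact measureReal_nonneg⟩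
    -- The marginal infima, taken as `y`, need not be attained. Minimizing sequences can be combined
    -- freely across `k`, so the product bound passes to the limit.
    choose u _ hu huV using fun k => exists_seq_tendsto_sInf (hne k) (hbdd k)
    choose G hGb hGu using huV
    refine ⟨fun k => sInf (V k), fun k => ⟨le_csInf (hne k) ?_, ?_⟩, ?_, ?_⟩
    · rintro _ ⟨F, _, rfl⟩; exact measureReal_nonneg
    · exact (csInf_le (hbdd k) ⟨_, hself k, rfl⟩).trans measureReal_le_one
    · refine ge_of_tendsto' (tendsto_finsetProd Finset.univ fun k _ => hu k) fun n => ?_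
      simpa only [hGu] using h (fun k => G k n) fun k => hGb k n
    · exact fun k F hF => csInf_le (hbdd k) ⟨F, hF, rfl⟩
  · rintro ⟨y, hy, hprod, hle⟩ G hGb
    exact hprod.trans (Finset.prod_le_prod (fun k _ => (hy k).1) fun k _ => hle k _ (hGb k))

theorem mem_feasible_iff_exists (hδ : ∀ k, 0 ≤ J.δ k) (hε : 0 < J.ε)
    (hP : ∀ k, IsElliptical (J.P k) (D.μ k) (D.Q k) (D.ψ k))
    (hν : ∀ k, IsStdElliptical (D.ν k) (D.ψ k)) (τ : J.Vec) :
    τ ∈ J.feasible ↔ ∃ a y, (τ, a, y) ∈ D.feasible := by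
  have hprob : ∀ k, IsProbabilityMeasure (J.P k) := fun k => (hP k).isProb
  have hconstr : ∀ y : Fin K → ℝ, (∀ k, 0 ≤ y k ∧ y k ≤ 1) → J.ε ≤ ∏ k, y k → ∀ k,
      ((∀ F ∈ klBall (J.P k) (J.δ k), y k ≤ F.real {r | J.ξ k ≤ dot τ r}) ↔
        (J.ξ k : EReal) ≤ (dot τ (D.μ k) : EReal) +
          cdfInv (D.ν k) (1 - yTilde (J.δ k) (y k)) * (Real.sqrt (quad (D.Q k) τ) : EReal)) := by
    intro y hy hprod k
    -- A positive lower bound on the product excludes zero factors, as the strict Bernoulli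
    -- estimates require.
    have hypos : 0 < y k := lt_of_le_of_ne (hy k).1 fun h0 => by
      rw [Finset.prod_eq_zero (Finset.mem_univ k) h0.symm] at hprod
      linarith
    have hm : MeasurableSet {r : J.Vec | J.ξ k ≤ dot τ r} :=
      measurableSet_le measurable_const (measurable_dot τ)
    rw [← (hP k).le_measureReal_iff (hν k) τ (J.ξ k)
      (hypos.trans_le (self_le_yTilde (hδ k) (hy k).1 (hy k).2))
      (yTilde_le_one (hδ k) (hy k).1)]
    constructor
    · intro h
      by_contra! hlt
      obtain ⟨F, hF, hFlt⟩ := exists_mem_klBall_measureReal_lt (hδ k) hm hypos hlt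
      exact absurd (h F hF) (not_le.2 hFlt)
    · exact fun h F hF => le_measureReal_of_yTilde_le (hδ k) hm (hy k).2 h hF
  rw [mem_feasible_iff hprob]
  constructor
  · rintro ⟨hτ, y, hy, hprod, hF⟩
    exact ⟨0, y, fun k => (hconstr y hy hprod k).1 (hF k), hy, hprod, le_rfl, hτ⟩
  · rintro ⟨a, y, hc, hy, hprod, -, hτ⟩
    exact ⟨hτ, y, hy, hprod, fun k => (hconstr y hy hprod k).2 (hc k)⟩

theorem EllipticalData.feasible_of_nonneg {τ : J.Vec} {a b : ℝ} {y : Fin K → ℝ}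
    (h : (τ, a, y) ∈ D.feasible) (hb : 0 ≤ b) : (τ, b, y) ∈ D.feasible :=
  ⟨h.1, h.2.1, h.2.2.1, hb, h.2.2.2.2⟩

end Feasibility

end Reformulation

end DRCCMDP

theorem mainTheorem2 {S A : Type*} [Fintype S] {K : ℕ}
    (J : DRCCMDP.JointProblem S A K) (D : DRCCMDP.EllipticalData J)
    (hδ₀ : 0 ≤ J.δ₀) (hδ : ∀ k, 0 ≤ J.δ k)
    (hε : 0 < J.ε) (hε_le : J.ε ≤ 1)
    (hP₀ : DRCCMDP.IsElliptical J.P₀ D.μ₀ D.Q₀ D.ψ₀)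
    (hP : ∀ k, DRCCMDP.IsElliptical (J.P k) (D.μ k) (D.Q k) (D.ψ k))
    (hν : ∀ k, DRCCMDP.IsStdElliptical (D.ν k) (D.ψ k))
    (hQ₀ : D.Q₀.PosDef)
    (hψ₀_cont : Continuous D.ψ₀)
    (hψ₀_ext : AnalyticOnNhd ℝ D.ψ₀ (Set.Iic 0))
    (hψ₀_inf : ∀ t ≤ 0, Real.exp (-J.δ₀) ≤ D.ψ₀ t) :
    -- the expectations in the robust objective exist
    (∀ τ : J.Vec, ∀ F ∈ J.amb₀, Integrable (fun r => DRCCMDP.dot τ r) F) ∧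
    -- the feasible sets correspond
    (∀ τ : J.Vec, τ ∈ J.feasible ↔ ∃ α y, (τ, α, y) ∈ D.feasible) ∧
    -- the objectives correspond at every occupation measure
    (∀ τ ∈ J.occupation, J.objective τ =
      -(((1 / (1 - J.β) : ℝ) : EReal) * ⨅ α ∈ Set.Ici (0 : ℝ), D.objective τ α)) ∧
    -- the optimal values correspond
    J.value = -(((1 / (1 - J.β) : ℝ) : EReal) * D.value) ∧
    -- the optimal solutions correspond
    (∀ τ α y, D.IsOptimal (τ, α, y) → J.IsOptimal τ) ∧
    (0 < J.δ₀ → ∀ τ, J.IsOptimal τ → ∃ α y, D.IsOptimal (τ, α, y)) := by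
  have hfeas := DRCCMDP.mem_feasible_iff_exists hδ hε hP hν
  have hobj := DRCCMDP.objective_eq_neg_mul_worstLoss (J := J)
  have hinf := DRCCMDP.iInf_objective_eq_worstLoss hδ₀ hP₀ hψ₀_ext
  have hle := DRCCMDP.worstLoss_le_objective hδ₀ hP₀ hψ₀_ext
  have hc : 0 < 1 / (1 - J.β) := one_div_pos.2 (sub_pos.2 J.β_lt_one)
  refine ⟨fun τ F hF => DRCCMDP.integrable_dot_of_mem_amb₀ hP₀ hψ₀_ext τ hF, hfeas,
    fun τ _ => by rw [hinf, hobj], ?_, ?_, ?_⟩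
  · have hval : D.value = ⨅ τ ∈ J.feasible, DRCCMDP.worstLoss J τ := by
      refine le_antisymm (le_iInf₂ fun τ hτ => ?_) (le_iInf₂ fun z hz => ?_)
      · obtain ⟨a, y, hz⟩ := (hfeas τ).1 hτ
        rw [← hinf]
        exact le_iInf₂ fun b hb =>
          iInf₂_le_of_le (τ, b, y) (DRCCMDP.EllipticalData.feasible_of_nonneg hz hb) le_rfl
      · exact iInf₂_le_of_le z.1 ((hfeas z.1).2 ⟨z.2.1, z.2.2, hz⟩) (hle z.1 z.2.1)
    rw [hval, DRCCMDP.neg_mul_iInf₂ hc]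
    exact iSup_congr fun τ => iSup_congr fun _ => hobj τ
  · rintro τ a y ⟨hz, hmin⟩
    refine ⟨(hfeas τ).2 ⟨a, y, hz⟩, fun x hx => ?_⟩
    obtain ⟨b, y', hx'⟩ := (hfeas x).1 hx
    change J.objective x ≤ J.objective τ
    rw [hobj, hobj, DRCCMDP.neg_mul_le_neg_mul_iff hc]
    -- The loss at `τ` is at most the optimal dual value, which is at most the dual value at `x` for
    -- every `b' ≥ 0`; the infimum over `b'` is the loss at `x`.
    refine (hle τ a).trans ?_
    rw [← hinf x]
    exact le_iInf₂ fun b' hb' => hmin (DRCCMDP.EllipticalData.feasible_of_nonneg hx' hb')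
  · rintro hpos τ ⟨hτ, hmax⟩
    obtain ⟨a, ha, hle'⟩ := DRCCMDP.exists_objective_le_worstLoss hP₀ hψ₀_ext hpos τ
    obtain ⟨b, y, hz⟩ := (hfeas τ).1 hτ
    refine ⟨a, y, DRCCMDP.EllipticalData.feasible_of_nonneg hz ha, fun w hw => ?_⟩
    have hw' : w.1 ∈ J.feasible := (hfeas w.1).2 ⟨w.2.1, w.2.2, hw⟩
    have h1 : J.objective w.1 ≤ J.objective τ := hmax hw'
    rw [hobj, hobj, DRCCMDP.neg_mul_le_neg_mul_iff hc] at h1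
    exact hle'.trans (h1.trans (hle w.1 w.2.1))
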